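/- **Setting.** Let $\mathbb K=\mathbb C$ or $\mathbb R$, let $n\ge 1$, and let $a_1,\dots,a_m\in\mathbb K^n$ be independent random vectors with a common distribution, which is one of the following four. * Gaussian models: $\mathcal N(0,I_n/2)+i\,\mathcal N(0,I_n/2)$ with independent real and imaginary parts ($\mathbb K=\mathbb C$), or $\mathcal N(0,I_n)$ ($\mathbb K=\mathbb R$). * Uniform models: the uniform distribution on the sphere of radius $\sqrt n$ in $\mathbb C^n$ ($\mathbb K=\mathbb C$) or in $\mathbb R^n$ ($\mathbb K=\mathbb R$). For $x_0\in\mathbb K^n$ and $w\in\mathbb R^m$ put $b_i=|\langle a_i,x_0\rangle|^2+w_i$, $i=1,\dots,m$, and consider the program $$\text{minimize}\quad \sum_{i=1}^m\bigl|\operatorname{tr}(a_ia_i^*X)-b_i\bigr|\quad\text{subject to}\quad X\in\mathbb K^{n\times n},\ X\succeq 0. \tag{P}$$ **Theorem.** There are numerical constants $c_0,\gamma,C,C_0,K>0$ such that the following holds whenever $m\ge c_0n$. With probability at least $1-Ce^{-\gamma m}$ in the Gaussian models, and at least $1-Ce^{-\gamma n}$ in the uniform models, one has, for all $x_0\in\mathbb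 K^n$ and all $w\in\mathbb R^m$ simultaneously: (P) has a solution, and every solution $\hat X$ of (P) obeys $$\|\hat X-x_0x_0^*\|_F\le C_0\,\frac{\|w\|_1}{m}.$$ Moreover, let $\lambda$ be the largest eigenvalue of $\hat X$ and $u$ any unit eigenvector for $\lambda$. 1. If $x_0\ne0$, then $\hat x=\sqrt\lambda\,u$ satisfies, for some $c\in\mathbb K$ with $|c|=1$ (that is, $c=e^{i\phi}$ in the complex and $c=\pm1$ in the real case), $$\|\hat x-c\,x_0\|_2\le C_0\,\frac{\|w\|_1}{m\|x_0\|_2}.$$ In particular, $\|\hat x-c\,x_0\|_2\le C_0\min\bigl(\|x_0\|_2,\tfrac{\|w\|_1}{m\|x_0\|_2}\bigr)$ if $\|w\|_1\le m\|x_0\|_2^2$. 2. The estimate constructed from $(\lambda,u)$ and the noise level $\|w\|_1/m$ by $\hat x=\sqrt\lambda\,u$ if $\lambda\ge K\|w\|_1/m$, and $\hat x=0$ otherwise, satisfies, for some $c\in\mathbb K$ with $|c|=1$ and without any restriction on $x_0$ and $w$, $$\|\hat x-c\,x_0\|_2\le C_0\min\Bigl(\|x_0\|_2,\ \frac{\|w\|_1}{m\|x_0\|_2}\Bigr),$$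 where the minimum is read as $0$ if $x_0=0$. -/

import Mathlib

open MeasureTheory ProbabilityTheory
open scoped ComplexOrder

noncomputable section

namespace PhaseLift

section Laws

/-- The uniform distribution on the sphere of radius `r` centred at `0` of a finite-dimensional
real normed space: the normalized surface (cone) measure of the unit sphere, pushed forward
under `v ↦ r • v`. (It does not depend on the choice of the Haar measure.) -/
def uniformSphere (E : Type*) [NormedAddCommGroup E] [NormedSpace ℝ E] [FiniteDimensional ℝ E]
    [MeasurableSpace E] [BorelSpace E] (r : ℝ) : Measure E :=
  (((Measure.addHaar : Measure E).toSphere Set.univ)⁻¹ •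
    (Measure.addHaar : Measure E).toSphere).map
      (fun v : Metric.sphere (0 : E) 1 => r • (v : E))

/-- The real normal distribution `N(0, Iₙ)`. -/
def realGaussianModel (n : ℕ) : Measure (EuclideanSpace ℝ (Fin n)) :=
  stdGaussian (EuclideanSpace ℝ (Fin n))

/-- The complex normal distribution `N(0, Iₙ/2) + i N(0, Iₙ/2)`, with independent real and
imaginary parts. -/
def complexGaussianModel (n : ℕ) : Measure (EuclideanSpace ℂ (Fin n)) :=
  ((Measure.pi fun _ : Fin n => gaussianReal 0 (1 / 2)).prod
    (Measure.pi fun _ : Fin n => gaussianReal 0 (1 / 2))).map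
      (fun p => WithLp.toLp 2 fun j => (p.1 j : ℂ) + Complex.I * (p.2 j : ℂ))

/-- The uniform distribution on the real sphere of radius `√n`. -/
def realUniformModel (n : ℕ) : Measure (EuclideanSpace ℝ (Fin n)) :=
  uniformSphere (EuclideanSpace ℝ (Fin n)) (Real.sqrt n)

/-- The uniform distribution on the complex sphere of radius `√n`. -/
def complexUniformModel (n : ℕ) : Measure (EuclideanSpace ℂ (Fin n)) :=
  uniformSphere (EuclideanSpace ℂ (Fin n)) (Real.sqrt n)

/-- The random vectors `a₁, …, aₘ` are independent with common law `ν`. -/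
structure IsIID {Ω E : Type*} [MeasurableSpace Ω] [MeasurableSpace E] {m : ℕ}
    (a : Fin m → Ω → E) (ν : Measure E) (P : Measure Ω) : Prop where
  indep : iIndepFun a P
  law : ∀ i, HasLaw (a i) ν P

end Laws

section Recovery

variable {𝕜 : Type*} [RCLike 𝕜] {n m : ℕ}

/-- The rank-one matrix `x x^*`. -/
def outer (x : EuclideanSpace 𝕜 (Fin n)) : Matrix (Fin n) (Fin n) 𝕜 :=
  Matrix.vecMulVec x.ofLp (star x.ofLp)

/-- The Frobenius norm. -/
def frobeniusNorm (M : Matrix (Fin n) (Fin n) 𝕜) : ℝ :=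
  Real.sqrt (∑ i, ∑ j, ‖M i j‖ ^ 2)

/-- The `ℓ₁` norm of a real vector. -/
def l1Norm (w : Fin m → ℝ) : ℝ := ∑ i, |w i|

/-- The noisy data `bᵢ = |⟨aᵢ, x₀⟩|² + wᵢ`. -/
def noisyData (a : Fin m → EuclideanSpace 𝕜 (Fin n)) (x₀ : EuclideanSpace 𝕜 (Fin n))
    (w : Fin m → ℝ) : Fin m → ℝ :=
  fun i => ‖inner 𝕜 (a i) x₀‖ ^ 2 + w i

/-- The misfit `∑ᵢ |tr(aᵢ aᵢ^* X) - bᵢ|`. -/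
def l1Misfit (a : Fin m → EuclideanSpace 𝕜 (Fin n)) (b : Fin m → ℝ)
    (X : Matrix (Fin n) (Fin n) 𝕜) : ℝ :=
  ∑ i, ‖(outer (a i) * X).trace - ((b i : ℝ) : 𝕜)‖

/-- `X` minimizes the `ℓ₁` misfit over the positive semidefinite matrices. -/
def IsL1Fit (a : Fin m → EuclideanSpace 𝕜 (Fin n)) (b : Fin m → ℝ)
    (X : Matrix (Fin n) (Fin n) 𝕜) : Prop :=
  X.PosSemidef ∧ ∀ Z : Matrix (Fin n) (Fin n) 𝕜, Z.PosSemidef → l1Misfit a b X ≤ l1Misfit a b Z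

/-- `l` is the largest (real) eigenvalue of `X`, and `u` a unit eigenvector for it. -/
def IsTopEigenpair (X : Matrix (Fin n) (Fin n) 𝕜) (l : ℝ) (u : EuclideanSpace 𝕜 (Fin n)) : Prop :=
  ‖u‖ = 1 ∧ X.mulVec u.ofLp = ((l : ℝ) : 𝕜) • u.ofLp ∧
    ∀ l' : ℝ, Module.End.HasEigenvalue (Matrix.toLin' X) ((l' : ℝ) : 𝕜) → l' ≤ l

/-- The best rank-one factor `√l u` built from a top eigenpair `(l, u)`. -/
def spectralEstimate (l : ℝ) (u : EuclideanSpace 𝕜 (Fin n)) : EuclideanSpace 𝕜 (Fin n) :=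
  ((Real.sqrt l : ℝ) : 𝕜) • u

open Classical in
/-- The estimate built from a top eigenpair `(l, u)` and the threshold `t`: it is `√l u` if the
top eigenvalue reaches the threshold, and `0` otherwise. -/
def thresholdedEstimate (t l : ℝ) (u : EuclideanSpace 𝕜 (Fin n)) : EuclideanSpace 𝕜 (Fin n) :=
  if t ≤ l then spectralEstimate l u else 0

/-- Stable recovery from the measurement vectors `a₁, …, aₘ`, for all signals `x₀` and all noise
vectors `w` simultaneously, with error constant `C₀` and threshold constant `K`. -/
def StableRecovery (C₀ K : ℝ) (a : Fin m → EuclideanSpace 𝕜 (Fin n)) : Prop :=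
  ∀ (x₀ : EuclideanSpace 𝕜 (Fin n)) (w : Fin m → ℝ),
    (∃ X, IsL1Fit a (noisyData a x₀ w) X) ∧
    ∀ X, IsL1Fit a (noisyData a x₀ w) X →
      frobeniusNorm (X - outer x₀) ≤ C₀ * (l1Norm w / m) ∧
      ∀ (l : ℝ) (u : EuclideanSpace 𝕜 (Fin n)), IsTopEigenpair X l u →
        (x₀ ≠ 0 → ∃ c : 𝕜, ‖c‖ = 1 ∧
          ‖spectralEstimate l u - c • x₀‖ ≤ C₀ * (l1Norm w / (m * ‖x₀‖))) ∧
        (∃ c : 𝕜, ‖c‖ = 1 ∧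
          ‖thresholdedEstimate (K * (l1Norm w / m)) l u - c • x₀‖ ≤
            C₀ * min ‖x₀‖ (l1Norm w / (m * ‖x₀‖)))

end Recovery

end PhaseLift

end

namespace PhaseLift

/-! ### Deterministic recovery: an `ℓ₁` lower isometry bound implies everything claimed about (P).
-/

section Deterministic

open Matrix

variable {𝕜 : Type*} [RCLike 𝕜] {n m : ℕ}

/-! Everything follows from one uniform lower bound, `LowerIsometry`: the measurements of `X -
x₀x₀*`, for positive semidefinite `X`, have `ℓ₁` norm at least `c m ‖X - x₀x₀*‖_F`. Since `x₀x₀*` is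
feasible with misfit `‖w‖₁`, this bound makes the misfit coercive (so a minimizer exists) and puts
every minimizer within `(2/c)‖w‖₁/m` of `x₀x₀*`. Eigenvalue and eigenvector perturbation then give
the estimates for `√λ u`, and a threshold at twice the error level handles small signals
(`LowerIsometry.stableRecovery`).

The lower bound is proved by duality. `H = X - x₀x₀*` has at most one negative eigenvalue. Take
bounded weights `F i` whose weighted frame operator is at most `-c m` at the corresponding
eigenvector `v` and at least `c m` on unit vectors orthogonal to `v`. Pairing `F` with the
measurements of `H` gives at least `c m ∑|l j| ≥ c m ‖H‖_F`, and at most a constant times their `ℓ₁`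
norm (`HasCertificates.lowerIsometry`).

Weights that work are `exp(-s) - 3/8` at `s = |⟨a,v⟩|²` for Gaussian `a`. In direction `v` the mean
is `E[s exp(-s)] - 3/8 ≤ 1/4 - 3/8`. In a direction orthogonal to `v`, independence gives
`E[exp(-s)] - 3/8 ≥ 1/2 - 3/8`. Bernstein bounds on a net of the sphere, together with Lipschitz
continuity in the direction, make this uniform (`IsCertifying.pi_real_not_hasCertificates_le`); the
net has `exp(O(n))` points, which is beaten by `exp(-γm)` once `m ≥ c₀n`.

A uniform vector on the sphere is a normalized Gaussian one, `a = √n g/‖g‖`. A certificate for `g`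
becomes one for `a` with weights multiplied by `‖g‖²/n`. To keep these bounded, the weights are set
to zero where `‖g‖²` exceeds a large multiple of `n`, a rare event that changes the means only
slightly. All four models are thus treated together. -/

lemma trace_outer_mul (a : EuclideanSpace 𝕜 (Fin n)) (M : Matrix (Fin n) (Fin n) 𝕜) :
    (outer a * M).trace = star a.ofLp ⬝ᵥ M *ᵥ a.ofLp := by
  rw [outer, vecMulVec_mul, trace_vecMulVec, dotProduct_comm, dotProduct_mulVec]

lemma trace_outer_mul_eq_inner (a : EuclideanSpace 𝕜 (Fin n)) (M : Matrix (Fin n) (Fin n) 𝕜) :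
    (outer a * M).trace = inner 𝕜 a (WithLp.toLp 2 (M *ᵥ a.ofLp)) := by
  rw [trace_outer_mul, EuclideanSpace.inner_eq_star_dotProduct, dotProduct_comm]

lemma outer_mulVec (x y : EuclideanSpace 𝕜 (Fin n)) :
    outer x *ᵥ y.ofLp = inner 𝕜 x y • x.ofLp := by
  rw [outer, vecMulVec_mulVec, EuclideanSpace.inner_eq_star_dotProduct, dotProduct_comm]
  ext i; simp [mul_comm]

lemma trace_outer_mul_outer (a x : EuclideanSpace 𝕜 (Fin n)) :
    (outer a * outer x).trace = ((‖inner 𝕜 a x‖ ^ 2 : ℝ) : 𝕜) := by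
  rw [trace_outer_mul_eq_inner, outer_mulVec, WithLp.toLp_smul, inner_smul_right,
    ← inner_conj_symm x a, RCLike.conj_mul]
  push_cast; rfl

lemma isHermitian_outer (x : EuclideanSpace 𝕜 (Fin n)) : (outer x).IsHermitian := by
  ext i j
  simp [outer, vecMulVec_apply, mul_comm]

lemma posSemidef_outer (x : EuclideanSpace 𝕜 (Fin n)) : (outer x).PosSemidef :=
  posSemidef_vecMulVec_self_star _

lemma frobeniusNorm_eq_norm (M : Matrix (Fin n) (Fin n) 𝕜) :
    frobeniusNorm M =
      ‖(WithLp.toLp 2 fun p : Fin n × Fin n => M p.1 p.2 : EuclideanSpace 𝕜 (Fin n × Fin n))‖ := by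
  rw [EuclideanSpace.norm_eq, frobeniusNorm, Fintype.sum_prod_type]

lemma frobeniusNorm_nonneg (M : Matrix (Fin n) (Fin n) 𝕜) : 0 ≤ frobeniusNorm M :=
  Real.sqrt_nonneg _

lemma frobeniusNorm_sum_smul_le {ι : Type*} (s : Finset ι) (l : ι → ℝ)
    (M : ι → Matrix (Fin n) (Fin n) 𝕜) :
    frobeniusNorm (∑ j ∈ s, (l j : 𝕜) • M j) ≤ ∑ j ∈ s, |l j| * frobeniusNorm (M j) := by
  have h : (WithLp.toLp 2 fun p : Fin n × Fin n => (∑ j ∈ s, (l j : 𝕜) • M j) p.1 p.2 :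
      EuclideanSpace 𝕜 (Fin n × Fin n)) =
      ∑ j ∈ s, (l j : 𝕜) • WithLp.toLp 2 fun p : Fin n × Fin n => M j p.1 p.2 := by
    ext p; simp [Matrix.sum_apply]
  simp only [frobeniusNorm_eq_norm]
  rw [h]
  refine (norm_sum_le _ _).trans (Finset.sum_le_sum fun j _ => ?_)
  rw [norm_smul, RCLike.norm_ofReal]

lemma frobeniusNorm_outer (x : EuclideanSpace 𝕜 (Fin n)) : frobeniusNorm (outer x) = ‖x‖ ^ 2 := by
  have h : ∑ i, ∑ j, ‖outer x i j‖ ^ 2 = (‖x‖ ^ 2) ^ 2 := by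
    rw [EuclideanSpace.norm_sq_eq, sq (∑ i, ‖x i‖ ^ 2), Finset.sum_mul_sum]
    simp [outer, vecMulVec_apply, mul_pow]
  rw [frobeniusNorm, h, Real.sqrt_sq (by positivity)]

lemma norm_mulVec_le (M : Matrix (Fin n) (Fin n) 𝕜) (y : EuclideanSpace 𝕜 (Fin n)) :
    ‖(WithLp.toLp 2 (M *ᵥ y.ofLp) : EuclideanSpace 𝕜 (Fin n))‖ ≤ frobeniusNorm M * ‖y‖ := by
  refine (pow_le_pow_iff_left₀ (norm_nonneg _)
    (mul_nonneg (frobeniusNorm_nonneg M) (norm_nonneg y)) two_ne_zero).mp ?_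
  rw [mul_pow, frobeniusNorm, Real.sq_sqrt (by positivity), EuclideanSpace.norm_sq_eq,
    Finset.sum_mul]
  refine Finset.sum_le_sum fun i _ => ?_
  rw [EuclideanSpace.norm_sq_eq]
  refine le_trans ?_ (Finset.sum_mul_sq_le_sq_mul_sq Finset.univ (fun j => ‖M i j‖) (fun j => ‖y j‖))
  have h : ‖∑ j, M i j * y j‖ ≤ ∑ j, ‖M i j‖ * ‖y j‖ :=
    (norm_sum_le _ _).trans (Finset.sum_le_sum fun j _ => (norm_mul (M i j) (y j)).le)
  exact pow_le_pow_left₀ (norm_nonneg _) h 2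

lemma norm_trace_outer_mul_le (y : EuclideanSpace 𝕜 (Fin n)) (M : Matrix (Fin n) (Fin n) 𝕜) :
    ‖(outer y * M).trace‖ ≤ frobeniusNorm M * ‖y‖ ^ 2 := by
  rw [trace_outer_mul_eq_inner]
  calc _ ≤ ‖y‖ * ‖(WithLp.toLp 2 (M *ᵥ y.ofLp) : EuclideanSpace 𝕜 (Fin n))‖ := norm_inner_le_norm _ _
    _ ≤ ‖y‖ * (frobeniusNorm M * ‖y‖) := by gcongr; exact norm_mulVec_le M y
    _ = _ := by ring

/-- Spectral decomposition of a Hermitian matrix into rank-one pieces. -/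
lemma exists_eigenbasis {H : Matrix (Fin n) (Fin n) 𝕜} (hH : H.IsHermitian) :
    ∃ (e : OrthonormalBasis (Fin n) 𝕜 (EuclideanSpace 𝕜 (Fin n))) (l : Fin n → ℝ),
      H = ∑ j, (l j : 𝕜) • outer (e j) ∧ ∀ j, H *ᵥ (e j).ofLp = (l j : 𝕜) • (e j).ofLp := by
  have key : ∀ j, H *ᵥ (hH.eigenvectorBasis j).ofLp
      = (hH.eigenvalues j : 𝕜) • (hH.eigenvectorBasis j).ofLp := fun j => by
    rw [hH.mulVec_eigenvectorBasis]
    ext i; simp [RCLike.real_smul_eq_coe_mul]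
  refine ⟨hH.eigenvectorBasis, hH.eigenvalues, ?_, key⟩
  refine Matrix.mulVec_injective (funext fun x => ?_)
  have hx := hH.eigenvectorBasis.sum_repr' (WithLp.toLp 2 x)
  have hx' : x = ∑ j, inner 𝕜 (hH.eigenvectorBasis j) (WithLp.toLp 2 x) •
      (hH.eigenvectorBasis j).ofLp := by
    have := congrArg WithLp.ofLp hx
    simpa using this.symm
  have h1 : H *ᵥ x = ∑ j, inner 𝕜 (hH.eigenvectorBasis j) (WithLp.toLp 2 x) •
      (hH.eigenvalues j : 𝕜) • (hH.eigenvectorBasis j).ofLp := by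
    conv_lhs => rw [hx']
    rw [mulVec_sum]
    exact Finset.sum_congr rfl fun j _ => by rw [mulVec_smul, key]
  rw [h1, sum_mulVec]
  refine Finset.sum_congr rfl fun j _ => ?_
  rw [smul_mulVec, show x = (WithLp.toLp 2 x : EuclideanSpace 𝕜 (Fin n)).ofLp from rfl,
    outer_mulVec, smul_comm]

lemma trace_outer_mul_sum (y : EuclideanSpace 𝕜 (Fin n)) (e : Fin n → EuclideanSpace 𝕜 (Fin n))
    (l : Fin n → ℝ) :
    (outer y * ∑ j, (l j : 𝕜) • outer (e j)).trace =
      ((∑ j, l j * ‖inner 𝕜 y (e j)‖ ^ 2 : ℝ) : 𝕜) := by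
  rw [Finset.mul_sum, trace_sum]
  push_cast
  refine Finset.sum_congr rfl fun j _ => ?_
  rw [Matrix.mul_smul, trace_smul, trace_outer_mul_outer, smul_eq_mul]
  push_cast; rfl

lemma re_trace_outer_mul_nonneg {X : Matrix (Fin n) (Fin n) 𝕜} (hX : X.PosSemidef)
    (y : EuclideanSpace 𝕜 (Fin n)) : 0 ≤ RCLike.re (outer y * X).trace := by
  rw [trace_outer_mul]
  exact (RCLike.nonneg_iff.mp (hX.dotProduct_mulVec_nonneg y.ofLp)).1

/-- The lower isometry bound in the `ℓ₁` norm, on differences of a positive semidefinite matrix and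
a rank-one matrix. -/
def LowerIsometry (c : ℝ) (a : Fin m → EuclideanSpace 𝕜 (Fin n)) : Prop :=
  ∀ (x₀ : EuclideanSpace 𝕜 (Fin n)) (X : Matrix (Fin n) (Fin n) 𝕜), X.PosSemidef →
    c * m * frobeniusNorm (X - outer x₀) ≤ ∑ i, ‖(outer (a i) * (X - outer x₀)).trace‖

lemma noisyData_residual (a : Fin m → EuclideanSpace 𝕜 (Fin n)) (x₀ : EuclideanSpace 𝕜 (Fin n))
    (w : Fin m → ℝ) (X : Matrix (Fin n) (Fin n) 𝕜) (i : Fin m) :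
    (outer (a i) * X).trace - ((noisyData a x₀ w i : ℝ) : 𝕜) =
      (outer (a i) * (X - outer x₀)).trace - ((w i : ℝ) : 𝕜) := by
  rw [mul_sub, trace_sub, trace_outer_mul_outer, noisyData]
  push_cast; ring

lemma l1Misfit_outer (a : Fin m → EuclideanSpace 𝕜 (Fin n)) (x₀ : EuclideanSpace 𝕜 (Fin n))
    (w : Fin m → ℝ) : l1Misfit a (noisyData a x₀ w) (outer x₀) = l1Norm w := by
  simp [l1Misfit, l1Norm, noisyData_residual]

lemma l1Norm_nonneg (w : Fin m → ℝ) : 0 ≤ l1Norm w := Finset.sum_nonneg fun _ _ => abs_nonneg _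

/-- The residual of `X` is the measurement of `X - x₀x₀*` minus the noise, so the triangle
inequality suffices. It serves both as coercivity, for existence, and as the error bound for
minimizers. -/
lemma LowerIsometry.mul_frobeniusNorm_le {c : ℝ} {a : Fin m → EuclideanSpace 𝕜 (Fin n)}
    (h : LowerIsometry c a) (x₀ : EuclideanSpace 𝕜 (Fin n)) (w : Fin m → ℝ)
    {X : Matrix (Fin n) (Fin n) 𝕜} (hX : X.PosSemidef) :
    c * m * frobeniusNorm (X - outer x₀) ≤ l1Misfit a (noisyData a x₀ w) X + l1Norm w := by
  refine (h x₀ X hX).trans ?_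
  rw [l1Misfit, l1Norm, ← Finset.sum_add_distrib]
  refine Finset.sum_le_sum fun i _ => ?_
  rw [noisyData_residual]
  have := norm_le_norm_sub_add (outer (a i) * (X - outer x₀)).trace ((w i : ℝ) : 𝕜)
  rwa [RCLike.norm_ofReal] at this

lemma LowerIsometry.frobeniusNorm_sub_le {c : ℝ} (hc : 0 < c) (hm : 0 < m)
    {a : Fin m → EuclideanSpace 𝕜 (Fin n)} (h : LowerIsometry c a) (x₀ : EuclideanSpace 𝕜 (Fin n))
    (w : Fin m → ℝ) {X : Matrix (Fin n) (Fin n) 𝕜} (hX : IsL1Fit a (noisyData a x₀ w) X) :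
    frobeniusNorm (X - outer x₀) ≤ 2 / c * (l1Norm w / m) := by
  have h1 := h.mul_frobeniusNorm_le x₀ w hX.1
  have h2 := hX.2 (outer x₀) (posSemidef_outer x₀)
  rw [l1Misfit_outer] at h2
  have hm' : (0 : ℝ) < m := by exact_mod_cast hm
  rw [div_mul_div_comm, le_div_iff₀ (by positivity)]
  linarith

lemma isClosed_posSemidef :
    IsClosed {X : Matrix (Fin n) (Fin n) 𝕜 | X.PosSemidef} := by
  have : {X : Matrix (Fin n) (Fin n) 𝕜 | X.PosSemidef} =
      {X | Xᴴ = X} ∩ ⋂ x : Fin n → 𝕜, {X | 0 ≤ star x ⬝ᵥ X *ᵥ x} := by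
    ext X
    simp [posSemidef_iff_dotProduct_mulVec, Matrix.IsHermitian]
  rw [this]
  refine (isClosed_eq (by fun_prop) continuous_id).inter (isClosed_iInter fun x => ?_)
  have h : Continuous fun X : Matrix (Fin n) (Fin n) 𝕜 => star x ⬝ᵥ X *ᵥ x := by fun_prop
  rw [show {X : Matrix (Fin n) (Fin n) 𝕜 | 0 ≤ star x ⬝ᵥ X *ᵥ x} =
      {X | 0 ≤ RCLike.re (star x ⬝ᵥ X *ᵥ x)} ∩ {X | RCLike.im (star x ⬝ᵥ X *ᵥ x) = 0} from
    Set.ext fun X => RCLike.nonneg_iff]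
  exact (isClosed_le continuous_const (RCLike.continuous_re.comp h)).inter
    (isClosed_eq (RCLike.continuous_im.comp h) continuous_const)

lemma continuous_frobeniusNorm :
    Continuous (frobeniusNorm : Matrix (Fin n) (Fin n) 𝕜 → ℝ) := by
  unfold frobeniusNorm
  refine Real.continuous_sqrt.comp (continuous_finsetSum _ fun i _ =>
    continuous_finsetSum _ fun j _ => ?_)
  exact ((continuous_id.matrix_elem i j).norm).pow 2

lemma isCompact_posSemidef_frobeniusNorm_sub_le (M : Matrix (Fin n) (Fin n) 𝕜) (B : ℝ) :
    IsCompact {X : Matrix (Fin n) (Fin n) 𝕜 | X.PosSemidef ∧ frobeniusNorm (X - M) ≤ B} := by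
  let f : EuclideanSpace 𝕜 (Fin n × Fin n) → Matrix (Fin n) (Fin n) 𝕜 :=
    fun v => Matrix.of fun i j => v (i, j)
  have hf : Continuous f := by
    refine continuous_matrix fun i j => ?_
    simp only [f, Matrix.of_apply]
    fun_prop
  have hball := (isCompact_closedBall
    (WithLp.toLp 2 fun p : Fin n × Fin n => M p.1 p.2 : EuclideanSpace 𝕜 (Fin n × Fin n)) B).image hf
  refine hball.of_isClosed_subset
    (isClosed_posSemidef.inter (isClosed_le (continuous_frobeniusNorm.comp (by fun_prop))
      continuous_const)) ?_
  rintro X ⟨-, hX⟩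
  refine ⟨WithLp.toLp 2 fun p : Fin n × Fin n => X p.1 p.2, ?_, by ext i j; rfl⟩
  rw [frobeniusNorm_eq_norm] at hX
  rw [mem_closedBall_iff_norm]
  exact hX

/-- Coercivity: outside the Frobenius ball of radius `B` about `x₀x₀*` the misfit is at least
`‖w‖₁`, its value at the centre. A minimizer over the compact part inside the ball is therefore
global. -/
lemma LowerIsometry.exists_isL1Fit {c : ℝ} (hc : 0 < c) (hm : 0 < m)
    {a : Fin m → EuclideanSpace 𝕜 (Fin n)} (h : LowerIsometry c a) (x₀ : EuclideanSpace 𝕜 (Fin n))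
    (w : Fin m → ℝ) : ∃ X, IsL1Fit a (noisyData a x₀ w) X := by
  have hm' : (0 : ℝ) < m := by exact_mod_cast hm
  set B := 2 * l1Norm w / (c * m) with hB
  have hB0 : 0 ≤ B := div_nonneg (mul_nonneg zero_le_two (l1Norm_nonneg w)) (by positivity)
  have hmem : outer x₀ ∈
      {X : Matrix (Fin n) (Fin n) 𝕜 | X.PosSemidef ∧ frobeniusNorm (X - outer x₀) ≤ B} := by
    refine ⟨posSemidef_outer x₀, ?_⟩
    rw [sub_self]
    simpa [frobeniusNorm] using hB0
  have hcont : Continuous (l1Misfit a (noisyData a x₀ w)) := by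
    unfold l1Misfit
    fun_prop
  obtain ⟨X, hX, hmin⟩ := (isCompact_posSemidef_frobeniusNorm_sub_le (outer x₀) B).exists_isMinOn
    ⟨_, hmem⟩ hcont.continuousOn
  refine ⟨X, hX.1, fun Z hZ => ?_⟩
  by_cases hZB : frobeniusNorm (Z - outer x₀) ≤ B
  · exact hmin ⟨hZ, hZB⟩
  · refine (hmin hmem).trans ?_
    rw [l1Misfit_outer]
    have h1 := h.mul_frobeniusNorm_le x₀ w hZ
    have h2 : c * m * B ≤ c * m * frobeniusNorm (Z - outer x₀) := by
      gcongr; exact (not_le.mp hZB).le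
    rw [hB, mul_div_cancel₀ _ (by positivity)] at h2
    linarith

/-! ### Perturbation of the leading eigenpair of `x₀x₀*`. -/

section Perturbation

variable {X : Matrix (Fin n) (Fin n) 𝕜} {x₀ u : EuclideanSpace 𝕜 (Fin n)} {l : ℝ}

lemma IsTopEigenpair.trace_outer_mul_self (h : IsTopEigenpair X l u) :
    (outer u * X).trace = (l : 𝕜) := by
  rw [trace_outer_mul_eq_inner, h.2.1, WithLp.toLp_smul, inner_smul_right]
  simp [inner_self_eq_norm_sq_to_K, h.1]

lemma IsTopEigenpair.nonneg (h : IsTopEigenpair X l u) (hX : X.PosSemidef) : 0 ≤ l := by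
  simpa [h.trace_outer_mul_self] using re_trace_outer_mul_nonneg hX u

lemma IsTopEigenpair.re_trace_le (h : IsTopEigenpair X l u) (hX : X.IsHermitian)
    (y : EuclideanSpace 𝕜 (Fin n)) : RCLike.re (outer y * X).trace ≤ l * ‖y‖ ^ 2 := by
  obtain ⟨e, t, hdec, heig⟩ := exists_eigenbasis hX
  have hle : ∀ j, t j ≤ l := fun j => h.2.2 _ <| by
    refine Module.End.hasEigenvalue_of_hasEigenvector (x := (e j).ofLp) ⟨?_, ?_⟩
    · rw [Module.End.mem_eigenspace_iff, Matrix.toLin'_apply, heig]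
    · intro h0
      have : e j = 0 := by ext i; simp [h0]
      exact e.orthonormal.ne_zero j this
  rw [hdec, trace_outer_mul_sum, RCLike.ofReal_re, ← e.sum_sq_norm_inner_left y, Finset.mul_sum]
  exact Finset.sum_le_sum fun j _ => by gcongr; exact hle j

/-- Weyl's inequality through quadratic forms: testing at `x₀` bounds `l` from below, testing at `u`
from above. The first test divides by `‖x₀‖²`, hence the separate case `x₀ = 0`. -/
lemma IsTopEigenpair.abs_sub_le (h : IsTopEigenpair X l u) (hX : X.PosSemidef) :
    |l - ‖x₀‖ ^ 2| ≤ frobeniusNorm (X - outer x₀) := by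
  have hre : ∀ y : EuclideanSpace 𝕜 (Fin n), |RCLike.re (outer y * X).trace - ‖inner 𝕜 y x₀‖ ^ 2| ≤
      frobeniusNorm (X - outer x₀) * ‖y‖ ^ 2 := fun y => by
    refine le_trans (le_of_eq_of_le ?_ (RCLike.abs_re_le_norm _))
      (norm_trace_outer_mul_le y (X - outer x₀))
    rw [mul_sub, trace_sub, trace_outer_mul_outer, map_sub, RCLike.ofReal_re]
  have hF := frobeniusNorm_nonneg (X - outer x₀)
  have hl := h.nonneg hX
  rw [abs_le]
  constructor
  · rcases eq_or_ne x₀ 0 with h0 | h0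
    · subst h0; simp at hF ⊢; linarith
    · have h1 := (abs_le.mp (hre x₀)).1
      have h2 := h.re_trace_le hX.1 x₀
      have hr : 0 < ‖x₀‖ ^ 2 := by have := norm_pos_iff.mpr h0; positivity
      have h3 : ‖inner 𝕜 x₀ x₀‖ ^ 2 = ‖x₀‖ ^ 2 * ‖x₀‖ ^ 2 := by
        rw [inner_self_eq_norm_sq_to_K]; simp; ring
      rw [h3] at h1
      have : ‖x₀‖ ^ 2 * ‖x₀‖ ^ 2 ≤ (l + frobeniusNorm (X - outer x₀)) * ‖x₀‖ ^ 2 := by linarith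
      linarith [le_of_mul_le_mul_right this hr]
  · have h1 := (abs_le.mp (hre u)).2
    rw [h.trace_outer_mul_self, h.1, RCLike.ofReal_re] at h1
    have h2 : ‖inner 𝕜 u x₀‖ ^ 2 ≤ ‖x₀‖ ^ 2 := by
      have := norm_inner_le_norm (𝕜 := 𝕜) u x₀
      rw [h.1, one_mul] at this
      gcongr
    linarith

lemma IsTopEigenpair.norm_smul_sub_le (h : IsTopEigenpair X l u) :
    ‖(l : 𝕜) • u - inner 𝕜 x₀ u • x₀‖ ≤ frobeniusNorm (X - outer x₀) := by
  have := norm_mulVec_le (X - outer x₀) u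
  rw [h.1, mul_one, sub_mulVec, h.2.1, outer_mulVec] at this
  exact this

lemma exists_phase (z : 𝕜) : ∃ c : 𝕜, ‖c‖ = 1 ∧ c * z = (‖z‖ : 𝕜) := by
  rcases eq_or_ne z 0 with rfl | hz
  · exact ⟨1, by simp, by simp⟩
  · have hz' : (‖z‖ : 𝕜) ≠ 0 := by simpa using hz
    refine ⟨(‖z‖ : 𝕜) * z⁻¹, ?_, by field_simp⟩
    rw [norm_mul, norm_inv, RCLike.norm_ofReal, abs_norm, mul_inv_cancel₀ (by simpa using hz)]

/-- A leading eigenvector of a perturbation of `x₀ x₀^*` is close to `x₀`, up to a phase. -/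
lemma IsTopEigenpair.exists_norm_spectralEstimate_sub_le (h : IsTopEigenpair X l u)
    (hX : X.PosSemidef) (hx : x₀ ≠ 0) {D : ℝ} (hD : frobeniusNorm (X - outer x₀) ≤ D) :
    ∃ c : 𝕜, ‖c‖ = 1 ∧ ‖spectralEstimate l u - c • x₀‖ ≤ 6 * (D / ‖x₀‖) := by
  obtain ⟨c, hc, hcz⟩ := exists_phase (inner 𝕜 u x₀)
  refine ⟨c, hc, ?_⟩
  have hr : 0 < ‖x₀‖ := norm_pos_iff.mpr hx
  have hl := h.nonneg hX
  have habs := (h.abs_sub_le hX (x₀ := x₀)).trans hD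
  have hD0 : 0 ≤ D := (frobeniusNorm_nonneg _).trans hD
  have hcomp := (h.norm_smul_sub_le (x₀ := x₀)).trans hD
  have hu := h.1
  set r := ‖x₀‖ with hrdef
  set ρ := ‖inner 𝕜 u x₀‖ with hρ
  have hρ0 : 0 ≤ ρ := norm_nonneg _
  have hρr : ρ ≤ r := by
    have := norm_inner_le_norm (𝕜 := 𝕜) u x₀
    rwa [hu, one_mul] at this
  rw [abs_le] at habs
  have hsq : Real.sqrt l ^ 2 = l := Real.sq_sqrt hl
  have hs0 := Real.sqrt_nonneg l
  set s := Real.sqrt l with hs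
  -- For `D ≤ r²/2` the top eigenvalue stays above `r²/2`, so direction and length can be compared
  -- separately. For larger `D` the triangle inequality `s + r` is already of order `D / r`.
  rcases le_or_gt D (r ^ 2 / 2) with hsmall | hlarge
  · have hlr : r ^ 2 / 2 ≤ l := by linarith
    -- the component of the eigenvector orthogonal to the signal
    have hc2 : l ^ 2 - 2 * l * ρ ^ 2 + ρ ^ 2 * r ^ 2 ≤ D ^ 2 := by
      have h1 : ‖(l : 𝕜) • u - inner 𝕜 x₀ u • x₀‖ ^ 2 ≤ D ^ 2 := by gcongr
      refine le_trans (le_of_eq ?_) h1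
      rw [@norm_sub_sq 𝕜, norm_smul, norm_smul, hu, RCLike.norm_ofReal, inner_smul_left,
        inner_smul_right, ← inner_conj_symm x₀ u, RCLike.norm_conj, ← hρ, ← hrdef, RCLike.conj_mul,
        ← hρ, RCLike.conj_ofReal, mul_pow, mul_pow, sq_abs]
      have : RCLike.re ((l : 𝕜) * (ρ : 𝕜) ^ 2) = l * ρ ^ 2 := by
        rw [← RCLike.ofReal_pow, ← RCLike.ofReal_mul, RCLike.ofReal_re]
      rw [this]; ring
    -- Multiplied by `r²`, the left side of `hc2` equals `l²(r² - ρ²) + ρ²(r² - l)²`; the last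
    -- square is dropped.
    have hortho : l ^ 2 * (r ^ 2 - ρ ^ 2) ≤ D ^ 2 * r ^ 2 := by
      nlinarith [sq_nonneg (ρ * (r ^ 2 - l)), mul_le_mul_of_nonneg_right hc2 (sq_nonneg r)]
    have hρ2 : r ^ 2 * (r ^ 2 - ρ ^ 2) ≤ 4 * D ^ 2 := by
      have h0 : 0 ≤ r ^ 2 - ρ ^ 2 := by nlinarith
      have h1 : (r ^ 2 / 2) ^ 2 * (r ^ 2 - ρ ^ 2) ≤ D ^ 2 * r ^ 2 :=
        le_trans (by gcongr) hortho
      have h2 : r ^ 2 * (r ^ 2 * (r ^ 2 - ρ ^ 2)) ≤ r ^ 2 * (4 * D ^ 2) := by nlinarith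
      exact le_of_mul_le_mul_left h2 (by positivity)
    have hdir : ‖(r : 𝕜) • u - c • x₀‖ ≤ 3 * (D / r) := by
      refine (pow_le_pow_iff_left₀ (norm_nonneg _) (by positivity) two_ne_zero).mp ?_
      rw [@norm_sub_sq 𝕜, norm_smul, norm_smul, hu, hc, RCLike.norm_ofReal, inner_smul_left,
        inner_smul_right, hcz, ← hrdef, RCLike.conj_ofReal, ← RCLike.ofReal_mul,
        RCLike.ofReal_re, abs_of_pos hr]
      rw [mul_div_assoc', div_pow, le_div_iff₀ (by positivity)]
      nlinarith [mul_nonneg (mul_nonneg hρ0 (sub_nonneg.mpr hρr)) (sq_nonneg r)]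
    -- Uses `(s - r)(s + r) = l - r²` and `s + r ≥ r`.
    have hrad : ‖(s : 𝕜) • u - (r : 𝕜) • u‖ ≤ D / r := by
      rw [← sub_smul, norm_smul, hu, mul_one, ← RCLike.ofReal_sub, RCLike.norm_ofReal,
        le_div_iff₀ hr]
      have h1 : |s - r| * (s + r) ≤ D := by
        rw [← abs_of_nonneg (by positivity : 0 ≤ s + r), ← abs_mul, abs_le]
        constructor <;> nlinarith
      nlinarith [abs_nonneg (s - r), mul_nonneg (abs_nonneg (s - r)) hs0]
    have := norm_sub_le_norm_sub_add_norm_sub ((s : 𝕜) • u) ((r : 𝕜) • u) (c • x₀)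
    have hDr : 0 ≤ D / r := by positivity
    calc ‖spectralEstimate l u - c • x₀‖ ≤ _ := this
      _ ≤ _ := by linarith
  · have h1 : ‖spectralEstimate l u - c • x₀‖ ≤ s + r := by
      refine (norm_sub_le _ _).trans (le_of_eq ?_)
      rw [spectralEstimate, norm_smul, norm_smul, hu, hc, RCLike.norm_ofReal, abs_of_nonneg hs0]
      ring
    refine h1.trans ?_
    rw [mul_div_assoc', le_div_iff₀ hr]
    have h2 : s * r ≤ 4 * D := by nlinarith [sq_nonneg (s - r)]
    nlinarith

end Perturbation

/-- The threshold `4/c` is twice the Frobenius error constant `2/c`. An eigenvalue above it forces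
`(2/c)t ≤ ‖x₀‖²` with `t = ‖w‖₁/m`, so the error is also `O(‖x₀‖)`; one below it forces `‖x₀‖² ≤
3(2/c)t`, so the estimate `0` is good enough. The summand `1` keeps the constant above `1`, as the
estimate `0` requires. -/
lemma LowerIsometry.stableRecovery {c : ℝ} (hc : 0 < c) (hm : 0 < m)
    {a : Fin m → EuclideanSpace 𝕜 (Fin n)} (h : LowerIsometry c a) :
    StableRecovery (6 * (2 / c + 1)) (4 / c) a := by
  intro x₀ w
  refine ⟨h.exists_isL1Fit hc hm x₀ w, fun X hX => ?_⟩
  have hF := h.frobeniusNorm_sub_le hc hm x₀ w hX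
  have hm' : (0 : ℝ) < m := by exact_mod_cast hm
  have hw : 0 ≤ l1Norm w / m := div_nonneg (l1Norm_nonneg w) hm'.le
  have hC : 0 < 2 / c := by positivity
  have hcoef : 2 / c ≤ 2 / c + 1 := by linarith
  have hdiv : l1Norm w / (m * ‖x₀‖) = l1Norm w / m / ‖x₀‖ := by rw [div_div]
  refine ⟨hF.trans (by gcongr; linarith), fun l u hlu => ⟨fun hx => ?_, ?_⟩⟩
  · obtain ⟨z, hz, hle⟩ := hlu.exists_norm_spectralEstimate_sub_le hX.1 hx hF
    refine ⟨z, hz, hle.trans ?_⟩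
    rw [hdiv, mul_div_assoc, ← mul_assoc]
    gcongr
  · have habs := abs_le.mp ((hlu.abs_sub_le hX.1 (x₀ := x₀)).trans hF)
    have hl := hlu.nonneg hX.1
    rw [hdiv]
    set t := l1Norm w / m with ht
    have hK : 4 / c * t = 2 * (2 / c * t) := by ring
    have hCt : 0 ≤ 2 / c * t := by positivity
    rcases eq_or_ne x₀ 0 with rfl | hx
    · refine ⟨1, by simp, ?_⟩
      have : thresholdedEstimate (4 / c * t) l u = 0 := by
        rw [thresholdedEstimate]
        split_ifs with hle
        · rw [norm_zero] at habs
          have : l = 0 := by rw [hK] at hle; nlinarith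
          simp [spectralEstimate, this]
        · rfl
      rw [this]; simp
    · have hr : 0 < ‖x₀‖ := norm_pos_iff.mpr hx
      rw [thresholdedEstimate]
      split_ifs with hle
      · rw [hK] at hle
        obtain ⟨z, hz, hb⟩ := hlu.exists_norm_spectralEstimate_sub_le hX.1 hx hF
        refine ⟨z, hz, ?_⟩
        rw [mul_min_of_nonneg _ _ (by positivity)]
        refine le_min (hb.trans ?_) (hb.trans ?_)
        · have h1 : 2 / c * t / ‖x₀‖ ≤ ‖x₀‖ := by
            rw [div_le_iff₀ hr]; nlinarith
          have h2 : ‖x₀‖ ≤ (2 / c + 1) * ‖x₀‖ := by nlinarith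
          linarith
        · rw [mul_div_assoc, ← mul_assoc]
          gcongr
      · rw [hK] at hle
        refine ⟨1, by simp, ?_⟩
        rw [zero_sub, norm_neg, one_smul, mul_min_of_nonneg _ _ (by positivity)]
        refine le_min (by nlinarith) ?_
        rw [mul_div_assoc', le_div_iff₀ hr]
        nlinarith

/-- Dual certificates: for every direction `v` there are weights supported on the measurements of
squared norm at most `ρ` whose weighted frame operator is negative at `v` and uniformly positive
on the orthogonal complement of `v`. -/
def HasCertificates (𝕜 : Type*) [RCLike 𝕜] {E : Type*} [NormedAddCommGroup E]
    [InnerProductSpace 𝕜 E] (ρ c : ℝ) (a : Fin m → E) : Prop :=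
  ∀ v : E, ‖v‖ = 1 → ∃ f : Fin m → ℝ,
    (∀ i, |f i| ≤ 1) ∧ (∀ i, f i ≠ 0 → ‖a i‖ ^ 2 ≤ ρ) ∧
    ∑ i, f i * ‖inner 𝕜 (a i) v‖ ^ 2 ≤ -(c * m) ∧
    ∀ u : E, ‖u‖ = 1 → inner 𝕜 v u = 0 → c * m ≤ ∑ i, f i * ‖inner 𝕜 (a i) u‖ ^ 2

/-- A positive semidefinite matrix minus a rank-one matrix has at most one negative eigenvalue. -/
lemma eigenvalue_sub_outer_nonneg {X : Matrix (Fin n) (Fin n) 𝕜} (hX : X.PosSemidef)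
    {x₀ : EuclideanSpace 𝕜 (Fin n)} {e : OrthonormalBasis (Fin n) 𝕜 (EuclideanSpace 𝕜 (Fin n))}
    {l : Fin n → ℝ} (hdec : X - outer x₀ = ∑ j, (l j : 𝕜) • outer (e j)) {j k : Fin n}
    (hjk : k ≠ j) (hj : l j < 0) : 0 ≤ l k := by
  have key : ∀ y : EuclideanSpace 𝕜 (Fin n),
      0 ≤ ∑ i, l i * ‖inner 𝕜 y (e i)‖ ^ 2 + ‖inner 𝕜 y x₀‖ ^ 2 := fun y => by
    have h1 := re_trace_outer_mul_nonneg hX y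
    rw [show X = (X - outer x₀) + outer x₀ by abel, mul_add, trace_add, hdec, trace_outer_mul_sum,
      trace_outer_mul_outer, map_add, RCLike.ofReal_re, RCLike.ofReal_re] at h1
    exact h1
  have hsum : ∀ α β : 𝕜, ∑ i, l i * ‖inner 𝕜 (β • e j - α • e k) (e i)‖ ^ 2 =
      l j * ‖β‖ ^ 2 + l k * ‖α‖ ^ 2 := fun α β => by
    have : ∀ i, l i * ‖inner 𝕜 (β • e j - α • e k) (e i)‖ ^ 2 =
        (if i = j then l j * ‖β‖ ^ 2 else 0) + (if i = k then l k * ‖α‖ ^ 2 else 0) := fun i => by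
      rw [inner_sub_left, inner_smul_left, inner_smul_left, e.inner_eq_ite, e.inner_eq_ite]
      rcases eq_or_ne i j with rfl | h1
      · simp [hjk, hjk.symm]
      · rcases eq_or_ne i k with rfl | h2
        · simp [hjk, hjk.symm]
        · simp [h1, h2, h1.symm, h2.symm]
    simp [this, Finset.sum_add_distrib]
  -- If `e j` were orthogonal to `x₀`, the form of `X` at `e j` would be `l j < 0`.
  have hα : inner 𝕜 x₀ (e j) ≠ 0 := fun h0 => by
    have h1 := key ((1 : 𝕜) • e j - (0 : 𝕜) • e k)
    rw [hsum, zero_smul, sub_zero, one_smul, ← inner_conj_symm, h0] at h1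
    simp at h1
    linarith
  by_contra! hk
  -- This combination of the two eigenvectors is orthogonal to `x₀`, so the forms of `X` and `X -
  -- x₀x₀*` agree on it; two negative eigenvalues would make the value negative.
  have h1 := key (inner 𝕜 x₀ (e k) • e j - inner 𝕜 x₀ (e j) • e k)
  rw [hsum, ← inner_conj_symm (inner 𝕜 x₀ (e k) • e j - _), inner_sub_right, inner_smul_right,
    inner_smul_right, mul_comm (inner 𝕜 x₀ (e j)), sub_self] at h1
  have h2 : 0 < ‖inner 𝕜 x₀ (e j)‖ ^ 2 := by have := norm_pos_iff.mpr hα; positivity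
  simp at h1
  nlinarith [sq_nonneg ‖inner 𝕜 x₀ (e k)‖, mul_neg_of_neg_of_pos hk h2,
    mul_nonpos_of_nonpos_of_nonneg hj.le (sq_nonneg ‖inner 𝕜 x₀ (e k)‖)]

/-- Certificates for `g` yield the lower isometry bound for measurements proportional to `g`. -/
lemma HasCertificates.lowerIsometry {ρ c B : ℝ} (hc : 0 < c) (hB : 0 < B)
    {g a : Fin m → EuclideanSpace 𝕜 (Fin n)} (h : HasCertificates 𝕜 ρ c g)
    (hga : ∀ i, ∃ t : ℝ, 0 ≤ t ∧ (‖g i‖ ^ 2 ≤ ρ → t ≤ B) ∧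
      ∀ u, ‖inner 𝕜 (g i) u‖ ^ 2 = t * ‖inner 𝕜 (a i) u‖ ^ 2) :
    LowerIsometry (c / B) a := by
  -- The scale factors `t i` are absorbed into the weights. They may be huge, but only where `f i =
  -- 0`.
  have hcert : ∀ v : EuclideanSpace 𝕜 (Fin n), ‖v‖ = 1 → ∃ F : Fin m → ℝ, (∀ i, |F i| ≤ B) ∧
      ∑ i, F i * ‖inner 𝕜 (a i) v‖ ^ 2 ≤ -(c * m) ∧
      ∀ u : EuclideanSpace 𝕜 (Fin n), ‖u‖ = 1 → inner 𝕜 v u = 0 →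
        c * m ≤ ∑ i, F i * ‖inner 𝕜 (a i) u‖ ^ 2 := by
    intro v hv
    obtain ⟨f, hf1, hfR, hfv, hfu⟩ := h v hv
    choose t ht0 htB ht using hga
    have heq : ∀ u, ∑ i, f i * t i * ‖inner 𝕜 (a i) u‖ ^ 2 = ∑ i, f i * ‖inner 𝕜 (g i) u‖ ^ 2 :=
      fun u => Finset.sum_congr rfl fun i _ => by rw [ht, mul_assoc]
    refine ⟨fun i => f i * t i, fun i => ?_, by rwa [heq], fun u hu huv => by
      rw [heq]; exact hfu u hu huv⟩
    rcases eq_or_ne (f i) 0 with h0 | h0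
    · simp [h0, hB.le]
    · rw [abs_mul, abs_of_nonneg (ht0 i)]
      calc |f i| * t i ≤ 1 * B := by
            gcongr
            · exact ht0 i
            · exact hf1 i
            · exact htB i (hfR i h0)
        _ = B := one_mul B
  intro x₀ X hX
  obtain ⟨e, l, hdec, -⟩ := exists_eigenbasis (hX.1.sub (isHermitian_outer x₀))
  -- The certificate is taken at the negative eigenvector. If there is none, the constant weight `B`
  -- works, because it dominates minus the certificate at each `e j`.
  have hweights : ∃ F : Fin m → ℝ, (∀ i, |F i| ≤ B) ∧
      ∀ j, c * m * |l j| ≤ l j * ∑ i, F i * ‖inner 𝕜 (a i) (e j)‖ ^ 2 := by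
    by_cases hneg : ∃ j, l j < 0
    · obtain ⟨j₀, hj₀⟩ := hneg
      obtain ⟨F, hF, hFv, hFu⟩ := hcert (e j₀) (e.norm_eq_one j₀)
      refine ⟨F, hF, fun j => ?_⟩
      rcases eq_or_ne j j₀ with rfl | hj
      · rw [abs_of_neg hj₀]; nlinarith
      · have hl := eigenvalue_sub_outer_nonneg hX hdec hj hj₀
        have := hFu (e j) (e.norm_eq_one j) (e.inner_eq_zero hj.symm)
        rw [abs_of_nonneg hl]; nlinarith
    · push Not at hneg
      refine ⟨fun _ => B, fun _ => (abs_of_pos hB).le, fun j => ?_⟩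
      obtain ⟨F, hF, hFv, -⟩ := hcert (e j) (e.norm_eq_one j)
      rw [abs_of_nonneg (hneg j), mul_comm]
      refine mul_le_mul_of_nonneg_left ?_ (hneg j)
      have : -∑ i, F i * ‖inner 𝕜 (a i) (e j)‖ ^ 2 ≤ ∑ i, B * ‖inner 𝕜 (a i) (e j)‖ ^ 2 := by
        rw [← Finset.sum_neg_distrib]
        refine Finset.sum_le_sum fun i _ => ?_
        rw [← neg_mul]
        gcongr
        exact (neg_le_abs _).trans (hF i)
      linarith
  obtain ⟨F, hF, hFl⟩ := hweights
  -- The Frobenius norm is at most the nuclear norm, which is what the dual pairing controls.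
  have hfrob : frobeniusNorm (X - outer x₀) ≤ ∑ j, |l j| := by
    rw [hdec]
    refine (frobeniusNorm_sum_smul_le _ _ _).trans (le_of_eq (Finset.sum_congr rfl fun j _ => ?_))
    rw [frobeniusNorm_outer, e.norm_eq_one, one_pow, mul_one]
  have hcm : 0 ≤ c * m := by positivity
  have hupper : ∑ i, F i * ∑ j, l j * ‖inner 𝕜 (a i) (e j)‖ ^ 2 ≤
      B * ∑ i, ‖(outer (a i) * (X - outer x₀)).trace‖ := by
    rw [Finset.mul_sum]
    refine Finset.sum_le_sum fun i _ => ?_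
    rw [hdec, trace_outer_mul_sum, RCLike.norm_ofReal]
    refine (le_abs_self _).trans ?_
    rw [abs_mul]
    gcongr
    exact hF i
  have hlower : c * m * ∑ j, |l j| ≤ ∑ i, F i * ∑ j, l j * ‖inner 𝕜 (a i) (e j)‖ ^ 2 := by
    rw [Finset.mul_sum]
    refine (Finset.sum_le_sum fun j _ => hFl j).trans (le_of_eq ?_)
    simp_rw [Finset.mul_sum]
    rw [Finset.sum_comm]
    exact Finset.sum_congr rfl fun i _ => Finset.sum_congr rfl fun j _ => by ring
  have : c * m * frobeniusNorm (X - outer x₀) ≤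
      B * ∑ i, ‖(outer (a i) * (X - outer x₀)).trace‖ :=
    (mul_le_mul_of_nonneg_left hfrob hcm).trans (hlower.trans hupper)
  rw [div_mul_eq_mul_div, div_mul_eq_mul_div, div_le_iff₀ hB]
  linarith

end Deterministic

/-! ### Nets of the unit sphere. -/

section Nets

variable {E : Type*} [NormedAddCommGroup E] [NormedSpace ℝ E] [FiniteDimensional ℝ E]

open Metric Module

/-- Volumetric bound on the cardinality of separated subsets of the unit ball. -/
lemma card_le_of_separated {δ : ℝ} (hδ : 0 < δ) (s : Finset E) (hs : ∀ x ∈ s, ‖x‖ ≤ 1)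
    (h : ∀ x ∈ s, ∀ y ∈ s, x ≠ y → δ ≤ ‖x - y‖) : (s.card : ℝ) ≤ (1 + 2 / δ) ^ finrank ℝ E := by
  borelize E
  let μ : Measure E := Measure.addHaar
  have hδ2 : 0 < δ / 2 := by positivity
  have hρ : 0 < 1 + δ / 2 := by positivity
  have hdisj : Set.Pairwise (s : Set E)
      (Function.onFun Disjoint fun x => ball (x : E) (δ / 2)) := by
    intro x hx y hy hxy
    refine ball_disjoint_ball ?_
    rw [dist_eq_norm, add_halves]
    exact h x hx y hy hxy
  have hsub : (⋃ x ∈ s, ball (x : E) (δ / 2)) ⊆ ball (0 : E) (1 + δ / 2) := by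
    refine Set.iUnion₂_subset fun x hx => ball_subset_ball' ?_
    rw [dist_zero_right]
    linarith [hs x hx]
  have hvol : (s.card : ENNReal) * ENNReal.ofReal ((δ / 2) ^ finrank ℝ E) * μ (ball 0 1) ≤
      ENNReal.ofReal ((1 + δ / 2) ^ finrank ℝ E) * μ (ball 0 1) := by
    calc _ = μ (⋃ x ∈ s, ball (x : E) (δ / 2)) := by
          rw [measure_biUnion_finset hdisj fun c _ => measurableSet_ball]
          simp only [μ.addHaar_ball_of_pos _ hδ2, Finset.sum_const, nsmul_eq_mul, mul_assoc]
      _ ≤ μ (ball (0 : E) (1 + δ / 2)) := measure_mono hsub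
      _ = _ := by simp only [μ.addHaar_ball_of_pos _ hρ]
  have hcard : (s.card : ENNReal) * ENNReal.ofReal ((δ / 2) ^ finrank ℝ E) ≤
      ENNReal.ofReal ((1 + δ / 2) ^ finrank ℝ E) :=
    (ENNReal.mul_le_mul_iff_left (measure_ball_pos _ _ zero_lt_one).ne' measure_ball_lt_top.ne).1
      hvol
  have hreal := ENNReal.toReal_le_of_le_ofReal (by positivity) hcard
  rw [ENNReal.toReal_mul, ENNReal.toReal_natCast, ENNReal.toReal_ofReal (by positivity)] at hreal
  have : (1 + 2 / δ) ^ finrank ℝ E = (1 + δ / 2) ^ finrank ℝ E / (δ / 2) ^ finrank ℝ E := by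
    rw [← div_pow]; congr 1; field_simp; ring
  rw [this, le_div_iff₀ (by positivity)]
  exact hreal

variable (E) in
/-- Existence of nets of the unit sphere of exponential cardinality. -/
lemma exists_sphere_net {δ : ℝ} (hδ : 0 < δ) :
    ∃ N : Finset E, (∀ x ∈ N, ‖x‖ = 1) ∧ (∀ x : E, ‖x‖ = 1 → ∃ y ∈ N, ‖x - y‖ ≤ δ) ∧
      (N.card : ℝ) ≤ (1 + 2 / δ) ^ finrank ℝ E := by
  by_contra! hno
  -- Greedy construction: without a small net, every separated set can be enlarged, which
  -- contradicts the volumetric bound.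
  have hbuild : ∀ k : ℕ, ∃ s : Finset E, s.card = k ∧ (∀ x ∈ s, ‖x‖ = 1) ∧
      ∀ x ∈ s, ∀ y ∈ s, x ≠ y → δ ≤ ‖x - y‖ := by
    intro k
    induction k with
    | zero => exact ⟨∅, by simp⟩
    | succ k ih =>
      obtain ⟨s, hk, hs, hsep⟩ := ih
      have hcard := card_le_of_separated hδ s (fun x hx => (hs x hx).le) hsep
      have : ∃ x : E, ‖x‖ = 1 ∧ ∀ y ∈ s, δ < ‖x - y‖ := by
        by_contra! hcov
        exact (hno s hs hcov).not_ge hcard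
      obtain ⟨x, hx, hxs⟩ := this
      have hxn : x ∉ s := fun hmem => by
        have := hxs x hmem
        rw [sub_self, norm_zero] at this
        linarith
      classical
      refine ⟨insert x s, by rw [Finset.card_insert_of_notMem hxn, hk], ?_, ?_⟩
      · simp only [Finset.mem_insert]
        rintro y (rfl | hy)
        exacts [hx, hs y hy]
      · simp only [Finset.mem_insert]
        rintro y (rfl | hy) z (rfl | hz) hyz
        · exact absurd rfl hyz
        · exact (hxs z hz).le
        · rw [norm_sub_rev]; exact (hxs y hy).le
        · exact hsep y hy z hz hyz
  obtain ⟨k, hk⟩ := exists_nat_gt ((1 + 2 / δ) ^ finrank ℝ E)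
  obtain ⟨s, hs, hs1, hsep⟩ := hbuild k
  have := card_le_of_separated hδ s (fun x hx => (hs1 x hx).le) hsep
  rw [hs] at this
  linarith

end Nets

/-! ### Exponential tail bounds for independent sums. -/

section Chernoff

variable {E : Type*} [MeasurableSpace E] {ν : Measure E} [IsProbabilityMeasure ν] {m : ℕ}

/-- Chernoff's method: Markov's inequality for `exp(θ ∑ Z)`, whose expectation factorizes over the
product measure. -/
lemma pi_real_sum_ge_le {Z : E → ℝ} {θ t κ : ℝ} (hθ : 0 ≤ θ)
    (hinteg : Integrable (fun x => Real.exp (θ * Z x)) ν)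
    (hκ : ∫ x, Real.exp (θ * Z x) ∂ν ≤ Real.exp κ) :
    (Measure.pi fun _ : Fin m => ν).real {g | m * t ≤ ∑ i, Z (g i)} ≤
      Real.exp (m * (κ - θ * t)) := by
  have hprod : ∀ g : Fin m → E, Real.exp (θ * ∑ i, Z (g i)) = ∏ i, Real.exp (θ * Z (g i)) :=
    fun g => by rw [Finset.mul_sum, Real.exp_sum]
  have hinteg' : Integrable (fun g : Fin m → E => Real.exp (θ * ∑ i, Z (g i)))
      (Measure.pi fun _ : Fin m => ν) := by
    simp_rw [hprod]
    exact Integrable.fintype_prod (f := fun _ x => Real.exp (θ * Z x)) fun _ => hinteg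
  refine (measure_ge_le_exp_mul_mgf (m * t) hθ hinteg').trans ?_
  rw [mgf]
  simp_rw [hprod]
  rw [integral_fintype_prod_eq_pow (fun x => Real.exp (θ * Z x)), Fintype.card_fin]
  calc _ ≤ Real.exp (-θ * (m * t)) * Real.exp κ ^ m := by
        gcongr
    _ = _ := by rw [← Real.exp_nat_mul, ← Real.exp_add]; ring_nf

lemma exp_le_one_add_add_sq_mul_exp_abs (x : ℝ) :
    Real.exp x ≤ 1 + x + x ^ 2 * Real.exp |x| := by
  have h := Complex.norm_exp_sub_sum_le_norm_mul_exp (x : ℂ) 2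
  simp only [Finset.sum_range_succ, Finset.sum_range_zero, pow_zero, Nat.factorial, pow_one,
    Nat.cast_one, div_one, zero_add, Complex.norm_real, Real.norm_eq_abs, sq_abs] at h
  have h2 : Complex.exp x - (1 + x / ((1 * (0 + 1) : ℕ) : ℂ)) = ((Real.exp x - (1 + x) : ℝ) : ℂ) := by
    push_cast; simp
  rw [show Complex.exp (x : ℂ) - (1 + (x : ℂ) / _) = _ from h2, Complex.norm_real,
    Real.norm_eq_abs] at h
  linarith [le_abs_self (Real.exp x - (1 + x))]

/-- Bernstein-type bound for the moment generating function of a sub-exponential variable. -/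
lemma integral_exp_le_of_subexponential {Z s : E → ℝ} (hZ : Measurable Z)
    (hZs : ∀ x, |Z x| ≤ s x) (hinteg : Integrable (fun x => Real.exp (s x / 4)) ν)
    (hs2 : ∫ x, Real.exp (s x / 4) ∂ν ≤ 2) {θ : ℝ} (hθ0 : 0 ≤ θ) (hθ : θ ≤ 1 / 8) :
    Integrable (fun x => Real.exp (θ * Z x)) ν ∧
      ∫ x, Real.exp (θ * Z x) ∂ν ≤ Real.exp (θ * ∫ x, Z x ∂ν + 256 * θ ^ 2) := by
  have hZint : Integrable Z ν := by
    refine (hinteg.const_mul 4).mono' hZ.aestronglyMeasurable (ae_of_all _ fun x => ?_)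
    have := Real.add_one_le_exp (s x / 4)
    rw [Real.norm_eq_abs]
    linarith [hZs x]
  have hexp : ∀ x, |θ * Z x| ≤ s x / 8 := fun x => by
    rw [abs_mul, abs_of_nonneg hθ0]
    nlinarith [hZs x, abs_nonneg (Z x)]
  have hinteg' : Integrable (fun x => Real.exp (θ * Z x)) ν := by
    refine hinteg.mono' (by fun_prop) (ae_of_all _ fun x => ?_)
    rw [Real.norm_eq_abs, Real.abs_exp]
    gcongr
    linarith [hexp x, le_abs_self (θ * Z x), (abs_nonneg _).trans (hZs x)]
  refine ⟨hinteg', ?_⟩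
  -- The available exponent `s/4` is split in half: `s² ≤ 128 exp(s/8)` pays for the square, the
  -- other `exp(s/8)` for `exp|θZ|`.
  have hpt : ∀ x, Real.exp (θ * Z x) ≤ 1 + θ * Z x + 128 * θ ^ 2 * Real.exp (s x / 4) := fun x => by
    refine (exp_le_one_add_add_sq_mul_exp_abs _).trans ?_
    have h0 : 0 ≤ s x / 8 := by linarith [(abs_nonneg _).trans (hZs x)]
    have h1 : Z x ^ 2 ≤ s x ^ 2 := by rw [← sq_abs]; gcongr; exact hZs x
    have h2 : (s x / 8) ^ 2 / 2 ≤ Real.exp (s x / 8) := by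
      have := Real.quadratic_le_exp_of_nonneg h0
      linarith
    have h3 : Real.exp |θ * Z x| ≤ Real.exp (s x / 8) := Real.exp_le_exp.mpr (hexp x)
    have h4 : (θ * Z x) ^ 2 * Real.exp |θ * Z x| ≤ 128 * θ ^ 2 * Real.exp (s x / 4) := by
      calc (θ * Z x) ^ 2 * Real.exp |θ * Z x|
          ≤ (θ ^ 2 * (128 * Real.exp (s x / 8))) * Real.exp (s x / 8) := by
            rw [mul_pow]
            gcongr
            linarith
        _ = 128 * θ ^ 2 * (Real.exp (s x / 8) * Real.exp (s x / 8)) := by ring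
        _ = _ := by rw [← Real.exp_add]; ring_nf
    linarith
  calc ∫ x, Real.exp (θ * Z x) ∂ν
      ≤ ∫ x, (1 + θ * Z x + 128 * θ ^ 2 * Real.exp (s x / 4)) ∂ν :=
        integral_mono hinteg' (by fun_prop) hpt
    _ = 1 + θ * ∫ x, Z x ∂ν + 128 * θ ^ 2 * ∫ x, Real.exp (s x / 4) ∂ν := by
        rw [integral_add (by fun_prop) (by fun_prop), integral_add (by fun_prop) (by fun_prop),
          integral_const_mul, integral_const_mul]
        simp
    _ ≤ (θ * ∫ x, Z x ∂ν + 256 * θ ^ 2) + 1 := by nlinarith [sq_nonneg θ]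
    _ ≤ _ := Real.add_one_le_exp _

/-- Upper tail of a sum of independent copies of a sub-exponential variable. -/
lemma pi_real_sum_ge_le_of_subexponential {Z s : E → ℝ} (hZ : Measurable Z)
    (hZs : ∀ x, |Z x| ≤ s x) (hinteg : Integrable (fun x => Real.exp (s x / 4)) ν)
    (hs2 : ∫ x, Real.exp (s x / 4) ∂ν ≤ 2) {t : ℝ} (ht0 : 0 ≤ t) (ht : t ≤ 64) :
    (Measure.pi fun _ : Fin m => ν).real {g | m * (∫ x, Z x ∂ν + t) ≤ ∑ i, Z (g i)} ≤
      Real.exp (-(m * (t ^ 2 / 1024))) := by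
  -- This `θ` minimizes `256θ² - θt`, with minimum `-t²/1024`; the restriction `t ≤ 64` is `θ ≤
  -- 1/8`.
  obtain ⟨h1, h2⟩ := integral_exp_le_of_subexponential hZ hZs hinteg hs2 (θ := t / 512)
    (by positivity) (by linarith)
  refine (pi_real_sum_ge_le (by positivity) h1 h2).trans (le_of_eq ?_)
  congr 1; ring

end Chernoff

/-! ### Expected weighted moments of a certifying law. -/

section Certificates

/-- The profile of the dual certificate. -/
noncomputable def profile (s : ℝ) : ℝ := Real.exp (-s) - 3 / 8

lemma abs_profile_le {s : ℝ} (hs : 0 ≤ s) : |profile s| ≤ 1 := by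
  have h1 : Real.exp (-s) ≤ 1 := Real.exp_le_one_iff.mpr (by linarith)
  have h2 := Real.exp_pos (-s)
  rw [profile, abs_le]
  constructor <;> linarith

lemma measurable_profile : Measurable profile := by unfold profile; fun_prop

variable {𝕜 : Type*} [RCLike 𝕜] {E : Type*} [NormedAddCommGroup E] [InnerProductSpace 𝕜 E]

/-- The properties of the Gaussian laws on which the certificates rest: sub-exponential squared
marginals, and the signs of the profile-weighted second moments. -/
structure IsCertifying (𝕜 : Type*) [RCLike 𝕜] {E : Type*} [NormedAddCommGroup E]
    [InnerProductSpace 𝕜 E] [MeasurableSpace E] (ν : Measure E) : Prop where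
  integrable_exp : ∀ u : E, ‖u‖ = 1 → Integrable (fun a => Real.exp (‖inner 𝕜 a u‖ ^ 2 / 4)) ν
  integral_exp_le : ∀ u : E, ‖u‖ = 1 → ∫ a, Real.exp (‖inner 𝕜 a u‖ ^ 2 / 4) ∂ν ≤ 2
  integral_self_le : ∀ v : E, ‖v‖ = 1 →
    ∫ a, profile (‖inner 𝕜 a v‖ ^ 2) * ‖inner 𝕜 a v‖ ^ 2 ∂ν ≤ -(1 / 8)
  le_integral_orthogonal : ∀ u v : E, ‖u‖ = 1 → ‖v‖ = 1 → inner 𝕜 v u = 0 →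
    1 / 8 ≤ ∫ a, profile (‖inner 𝕜 a v‖ ^ 2) * ‖inner 𝕜 a u‖ ^ 2 ∂ν

open Classical in
/-- The weight of the certificate in direction `v`, truncated to squared norm at most `ρ`. -/
noncomputable def weight (𝕜 : Type*) [RCLike 𝕜] {E : Type*} [NormedAddCommGroup E]
    [InnerProductSpace 𝕜 E] (ρ : ℝ) (v a : E) : ℝ :=
  if ‖a‖ ^ 2 ≤ ρ then profile (‖inner 𝕜 a v‖ ^ 2) else 0

lemma abs_weight_le (ρ : ℝ) (v a : E) : |weight 𝕜 ρ v a| ≤ 1 := by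
  rw [weight]
  split_ifs
  · exact abs_profile_le (by positivity)
  · simp

/-- Pointwise comparison of squared moduli. -/
lemma abs_sq_inner_sub_sq_inner_le {δ : ℝ} (hδ : 0 < δ) (a u w : E) :
    |‖inner 𝕜 a u‖ ^ 2 - ‖inner 𝕜 a w‖ ^ 2| ≤
      (‖inner 𝕜 a (u - w)‖ ^ 2 / δ + δ * ‖inner 𝕜 a (u + w)‖ ^ 2) / 2 := by
  have h4 : (2 : 𝕜) * inner 𝕜 a u = inner 𝕜 a (u + w) + inner 𝕜 a (u - w) := by
    rw [inner_add_right, inner_sub_right]; ring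
  have h5 : (2 : 𝕜) * inner 𝕜 a w = inner 𝕜 a (u + w) - inner 𝕜 a (u - w) := by
    rw [inner_add_right, inner_sub_right]; ring
  have h6 := norm_add_le (inner 𝕜 a (u + w)) (inner 𝕜 a (u - w))
  have h7 := norm_sub_le (inner 𝕜 a (u + w)) (inner 𝕜 a (u - w))
  have h8 := abs_norm_sub_norm_le (inner 𝕜 a (u + w)) (inner 𝕜 a (u - w))
  have h9 := abs_norm_sub_norm_le (inner 𝕜 a (u + w)) (-inner 𝕜 a (u - w))
  rw [norm_neg, sub_neg_eq_add, ← h4, norm_mul, RCLike.norm_ofNat] at h9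
  rw [← h5, norm_mul, RCLike.norm_ofNat] at h8
  rw [← h4, norm_mul, RCLike.norm_ofNat] at h6
  rw [← h5, norm_mul, RCLike.norm_ofNat] at h7
  set P := ‖inner 𝕜 a (u + w)‖
  set Q := ‖inner 𝕜 a (u - w)‖
  set z := ‖inner 𝕜 a u‖
  set y := ‖inner 𝕜 a w‖
  have hz : 0 ≤ z := norm_nonneg _
  have hy : 0 ≤ y := norm_nonneg _
  have a6 : (2 * z) ^ 2 ≤ (P + Q) ^ 2 := by gcongr
  have a7 : (2 * y) ^ 2 ≤ (P + Q) ^ 2 := by gcongr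
  have a8 : (P - Q) ^ 2 ≤ (2 * y) ^ 2 :=
    sq_le_sq.mpr (by rwa [abs_of_nonneg (by positivity : 0 ≤ 2 * y)])
  have a9 : (P - Q) ^ 2 ≤ (2 * z) ^ 2 :=
    sq_le_sq.mpr (by rwa [abs_of_nonneg (by positivity : 0 ≤ 2 * z)])
  -- AM-GM weighted by `δ`: when `‖u - w‖ ≤ δ`, both terms have size `O(δ)` after summation or
  -- integration.
  have hPQ : 2 * (P * Q) ≤ Q ^ 2 / δ + δ * P ^ 2 := by
    rw [div_add' _ _ _ hδ.ne', le_div_iff₀ hδ]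
    nlinarith [sq_nonneg (Q - δ * P)]
  rw [abs_le]
  constructor <;> linarith

lemma exists_sq_inner_eq_mul (x : E) : ∃ u : E, (x ≠ 0 → ‖u‖ = 1) ∧
    ∀ a : E, ‖inner 𝕜 a x‖ ^ 2 = ‖x‖ ^ 2 * ‖inner 𝕜 a u‖ ^ 2 := by
  rcases eq_or_ne x 0 with rfl | hx
  · exact ⟨0, by simp⟩
  · refine ⟨((‖x‖⁻¹ : ℝ) : 𝕜) • x, fun _ => ?_, fun a => ?_⟩
    · rw [norm_smul, RCLike.norm_ofReal, abs_of_nonneg (by positivity),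
        inv_mul_cancel₀ (norm_ne_zero_iff.mpr hx)]
    · have := norm_ne_zero_iff.mpr hx
      rw [inner_smul_right, norm_mul, RCLike.norm_ofReal, abs_of_nonneg (by positivity)]
      field_simp

variable [MeasurableSpace E] [BorelSpace E]

variable (𝕜) in
lemma measurable_sq_inner (u : E) : Measurable fun a : E => ‖inner 𝕜 a u‖ ^ 2 := by
  have : Continuous fun a : E => ‖inner 𝕜 a u‖ ^ 2 := by fun_prop
  exact this.measurable

lemma measurable_weight (ρ : ℝ) (v : E) : Measurable (weight 𝕜 ρ v) := by
  unfold weight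
  refine Measurable.ite (measurableSet_le (by fun_prop) measurable_const) ?_ measurable_const
  exact measurable_profile.comp (measurable_sq_inner 𝕜 v)

namespace IsCertifying

variable {ν : Measure E}

lemma integrable_sq_inner_of_norm_eq_one (hν : IsCertifying 𝕜 ν) {u : E} (hu : ‖u‖ = 1) :
    Integrable (fun a => ‖inner 𝕜 a u‖ ^ 2) ν := by
  refine ((hν.integrable_exp u hu).const_mul 4).mono'
    (measurable_sq_inner 𝕜 u).aestronglyMeasurable (ae_of_all _ fun a => ?_)
  have := Real.add_one_le_exp (‖inner 𝕜 a u‖ ^ 2 / 4)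
  rw [Real.norm_of_nonneg (by positivity)]
  linarith

lemma integral_sq_inner_le_of_norm_eq_one (hν : IsCertifying 𝕜 ν) {u : E} (hu : ‖u‖ = 1) :
    ∫ a, ‖inner 𝕜 a u‖ ^ 2 ∂ν ≤ 8 := by
  calc _ ≤ ∫ a, 4 * Real.exp (‖inner 𝕜 a u‖ ^ 2 / 4) ∂ν := by
        refine integral_mono (hν.integrable_sq_inner_of_norm_eq_one hu)
          ((hν.integrable_exp u hu).const_mul 4) fun a => ?_
        have := Real.add_one_le_exp (‖inner 𝕜 a u‖ ^ 2 / 4)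
        dsimp only
        linarith
    _ ≤ _ := by
        rw [integral_const_mul]
        linarith [hν.integral_exp_le u hu]

lemma integrable_sq_inner (hν : IsCertifying 𝕜 ν) (x : E) :
    Integrable (fun a => ‖inner 𝕜 a x‖ ^ 2) ν := by
  rcases eq_or_ne x 0 with rfl | hx
  · simp
  · obtain ⟨u, hu, h⟩ := exists_sq_inner_eq_mul (𝕜 := 𝕜) x
    simp_rw [h]
    exact (hν.integrable_sq_inner_of_norm_eq_one (hu hx)).const_mul _

lemma integral_sq_inner_le (hν : IsCertifying 𝕜 ν) (x : E) :
    ∫ a, ‖inner 𝕜 a x‖ ^ 2 ∂ν ≤ 8 * ‖x‖ ^ 2 := by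
  rcases eq_or_ne x 0 with rfl | hx
  · simp
  · obtain ⟨u, hu, h⟩ := exists_sq_inner_eq_mul (𝕜 := 𝕜) x
    simp_rw [h]
    rw [integral_const_mul, mul_comm]
    gcongr
    exact hν.integral_sq_inner_le_of_norm_eq_one (hu hx)

lemma integrable_weighted (hν : IsCertifying 𝕜 ν) {f : E → ℝ} (hf : Measurable f)
    (hf1 : ∀ a, |f a| ≤ 1) (x : E) : Integrable (fun a => f a * ‖inner 𝕜 a x‖ ^ 2) ν := by
  refine (hν.integrable_sq_inner x).mono'
    (hf.mul (measurable_sq_inner 𝕜 x)).aestronglyMeasurable (ae_of_all _ fun a => ?_)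
  rw [norm_mul, Real.norm_eq_abs, Real.norm_of_nonneg (by positivity : 0 ≤ ‖inner 𝕜 a x‖ ^ 2)]
  nlinarith [hf1 a, sq_nonneg ‖inner 𝕜 a x‖]

/-- The truncation changes the weighted second moments by at most `1 / 16`. -/
lemma integral_tail_le [IsProbabilityMeasure ν] (hν : IsCertifying 𝕜 ν) {ρ : ℝ}
    (hρ : ν.real {a | ρ < ‖a‖ ^ 2} ≤ 1 / 2 ^ 14) (v : E) {u : E} (hu : ‖u‖ = 1) :
    |∫ a, profile (‖inner 𝕜 a v‖ ^ 2) * ‖inner 𝕜 a u‖ ^ 2 ∂ν -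
      ∫ a, weight 𝕜 ρ v a * ‖inner 𝕜 a u‖ ^ 2 ∂ν| ≤ 1 / 16 := by
  have hS : MeasurableSet {a : E | ρ < ‖a‖ ^ 2} := measurableSet_lt measurable_const (by fun_prop)
  have hi1 := hν.integrable_weighted (f := fun a => profile (‖inner 𝕜 a v‖ ^ 2))
    (measurable_profile.comp (measurable_sq_inner 𝕜 v)) (fun a => abs_profile_le (by positivity)) u
  have hi2 := hν.integrable_weighted (measurable_weight (𝕜 := 𝕜) ρ v) (abs_weight_le ρ v) u
  rw [← integral_sub hi1 hi2]
  have hind : Integrable (Set.indicator {a : E | ρ < ‖a‖ ^ 2} fun _ => (512 : ℝ)) ν :=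
    (integrable_const _).indicator hS
  have hexp := (hν.integrable_exp u hu).const_mul (1 / 64)
  -- On the tail, `s ≤ s²/2048 + 512 ≤ exp(s/4)/64 + 512`. Integrating gives `2/64 + 512/2^14 =
  -- 1/16`.
  have hpt : ∀ a, |profile (‖inner 𝕜 a v‖ ^ 2) * ‖inner 𝕜 a u‖ ^ 2 -
      weight 𝕜 ρ v a * ‖inner 𝕜 a u‖ ^ 2| ≤ 1 / 64 * Real.exp (‖inner 𝕜 a u‖ ^ 2 / 4) +
        Set.indicator {a : E | ρ < ‖a‖ ^ 2} (fun _ => (512 : ℝ)) a := fun a => by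
    by_cases ha : ‖a‖ ^ 2 ≤ ρ
    · rw [weight, if_pos ha, sub_self, abs_zero, Set.indicator_of_notMem (by simpa using ha)]
      positivity
    · rw [weight, if_neg ha, zero_mul, sub_zero, Set.indicator_of_mem (by simpa using ha), abs_mul,
        abs_of_nonneg (by positivity : 0 ≤ ‖inner 𝕜 a u‖ ^ 2)]
      have h1 := abs_profile_le (s := ‖inner 𝕜 a v‖ ^ 2) (by positivity)
      have h2 := Real.quadratic_le_exp_of_nonneg (x := ‖inner 𝕜 a u‖ ^ 2 / 4) (by positivity)
      set s := ‖inner 𝕜 a u‖ ^ 2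
      have hs : 0 ≤ s := by positivity
      have h3 : |profile (‖inner 𝕜 a v‖ ^ 2)| * s ≤ s := by nlinarith
      nlinarith [sq_nonneg (s - 1024)]
  calc _ ≤ ∫ a, |profile (‖inner 𝕜 a v‖ ^ 2) * ‖inner 𝕜 a u‖ ^ 2 -
      weight 𝕜 ρ v a * ‖inner 𝕜 a u‖ ^ 2| ∂ν := abs_integral_le_integral_abs
    _ ≤ ∫ a, (1 / 64 * Real.exp (‖inner 𝕜 a u‖ ^ 2 / 4) +
        Set.indicator {a : E | ρ < ‖a‖ ^ 2} (fun _ => (512 : ℝ)) a) ∂ν :=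
        integral_mono (hi1.sub hi2).abs (hexp.add hind) hpt
    _ ≤ 1 / 16 := by
        rw [integral_add hexp hind, integral_const_mul, integral_indicator hS, setIntegral_const,
          smul_eq_mul]
        linarith [hν.integral_exp_le u hu]

lemma abs_integral_weighted_sub_le (hν : IsCertifying 𝕜 ν) {f : E → ℝ} (hf : Measurable f)
    (hf1 : ∀ a, |f a| ≤ 1) {δ : ℝ} (hδ : 0 < δ) {u w : E} (hu : ‖u‖ ≤ 1) (hw : ‖w‖ ≤ 1)
    (huw : ‖u - w‖ ≤ δ) :
    |∫ a, f a * ‖inner 𝕜 a u‖ ^ 2 ∂ν - ∫ a, f a * ‖inner 𝕜 a w‖ ^ 2 ∂ν| ≤ 20 * δ := by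
  have hi1 := hν.integrable_weighted hf hf1 u
  have hi2 := hν.integrable_weighted hf hf1 w
  have hj1 := hν.integrable_sq_inner (u - w)
  have hj2 := hν.integrable_sq_inner (u + w)
  rw [← integral_sub hi1 hi2]
  have hsum : ‖u + w‖ ≤ 2 := (norm_add_le u w).trans (by linarith)
  calc _ ≤ ∫ a, |f a * ‖inner 𝕜 a u‖ ^ 2 - f a * ‖inner 𝕜 a w‖ ^ 2| ∂ν :=
        abs_integral_le_integral_abs
    _ ≤ ∫ a, (‖inner 𝕜 a (u - w)‖ ^ 2 / δ + δ * ‖inner 𝕜 a (u + w)‖ ^ 2) / 2 ∂ν := by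
        refine integral_mono (hi1.sub hi2).abs (((hj1.div_const _).add (hj2.const_mul _)).div_const _)
          fun a => ?_
        dsimp only
        rw [← mul_sub, abs_mul]
        refine le_trans ?_ (abs_sq_inner_sub_sq_inner_le hδ a u w)
        nlinarith [hf1 a, abs_nonneg (‖inner 𝕜 a u‖ ^ 2 - ‖inner 𝕜 a w‖ ^ 2)]
    _ = ((∫ a, ‖inner 𝕜 a (u - w)‖ ^ 2 ∂ν) / δ + δ * ∫ a, ‖inner 𝕜 a (u + w)‖ ^ 2 ∂ν) / 2 := by
        rw [integral_div, integral_add (hj1.div_const _) (hj2.const_mul _), integral_div,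
          integral_const_mul]
    _ ≤ (8 * δ ^ 2 / δ + δ * (8 * 2 ^ 2)) / 2 := by
        gcongr
        · exact (hν.integral_sq_inner_le _).trans (by gcongr)
        · exact (hν.integral_sq_inner_le _).trans (by gcongr)
    _ = 20 * δ := by field_simp; ring

lemma integral_weight_self_le [IsProbabilityMeasure ν] (hν : IsCertifying 𝕜 ν) {ρ : ℝ}
    (hρ : ν.real {a | ρ < ‖a‖ ^ 2} ≤ 1 / 2 ^ 14) {v : E} (hv : ‖v‖ = 1) :
    ∫ a, weight 𝕜 ρ v a * ‖inner 𝕜 a v‖ ^ 2 ∂ν ≤ -(1 / 16) := by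
  have h1 := hν.integral_self_le v hv
  have h2 := abs_le.mp (hν.integral_tail_le hρ v hv)
  linarith [h2.1]

lemma le_integral_weight_of_inner_eq_zero [IsProbabilityMeasure ν] (hν : IsCertifying 𝕜 ν) {ρ : ℝ}
    (hρ : ν.real {a | ρ < ‖a‖ ^ 2} ≤ 1 / 2 ^ 14) {u v : E} (hv : ‖v‖ = 1)
    (huv : inner 𝕜 v u = 0) :
    1 / 16 * ‖u‖ ^ 2 ≤ ∫ a, weight 𝕜 ρ v a * ‖inner 𝕜 a u‖ ^ 2 ∂ν := by
  rcases eq_or_ne u 0 with rfl | hu0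
  · simp
  have hn : ‖u‖ ≠ 0 := norm_ne_zero_iff.mpr hu0
  set w : E := ((‖u‖⁻¹ : ℝ) : 𝕜) • u with hw
  have hw1 : ‖w‖ = 1 := by
    rw [hw, norm_smul, RCLike.norm_ofReal, abs_of_nonneg (by positivity), inv_mul_cancel₀ hn]
  have hwv : inner 𝕜 v w = 0 := by rw [hw, inner_smul_right, huv, mul_zero]
  have hwu : ∀ a, weight 𝕜 ρ v a * ‖inner 𝕜 a u‖ ^ 2 =
      ‖u‖ ^ 2 * (weight 𝕜 ρ v a * ‖inner 𝕜 a w‖ ^ 2) := fun a => by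
    rw [hw, inner_smul_right, norm_mul, RCLike.norm_ofReal, abs_of_nonneg (by positivity)]
    field_simp
  simp_rw [hwu]
  rw [integral_const_mul, mul_comm]
  gcongr
  have h1 := hν.le_integral_orthogonal w v hw1 hv hwv
  have h2 := abs_le.mp (hν.integral_tail_le hρ v hw1)
  linarith [h2.2]

/-- Net points approximating orthogonal directions are only nearly orthogonal. Projecting `u` off
`v` restores orthogonality, and the Lipschitz bound makes the cost smaller than the gap between
`1/16` and `3/64`. -/
lemma le_integral_weight [IsProbabilityMeasure ν] (hν : IsCertifying 𝕜 ν) {ρ : ℝ}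
    (hρ : ν.real {a | ρ < ‖a‖ ^ 2} ≤ 1 / 2 ^ 14) {u v : E} (hu : ‖u‖ = 1) (hv : ‖v‖ = 1)
    (huv : ‖inner 𝕜 v u‖ ≤ 2 / 2 ^ 13) :
    3 / 64 ≤ ∫ a, weight 𝕜 ρ v a * ‖inner 𝕜 a u‖ ^ 2 ∂ν := by
  set p : E := u - inner 𝕜 v u • v with hp
  have hvv : inner 𝕜 v v = (1 : 𝕜) := by rw [inner_self_eq_norm_sq_to_K, hv]; simp
  have hpv : inner 𝕜 v p = 0 := by
    rw [hp, inner_sub_right, inner_smul_right, hvv, mul_one, sub_self]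
  have hup : ‖u - p‖ ≤ 2 / 2 ^ 13 := by
    rw [hp, sub_sub_cancel, norm_smul, hv, mul_one]; exact huv
  have hpyth : ‖p‖ ^ 2 + ‖inner 𝕜 v u‖ ^ 2 = 1 := by
    have hz : inner 𝕜 p (inner 𝕜 v u • v) = 0 := by
      rw [inner_smul_right, ← inner_conj_symm p v, hpv, map_zero, mul_zero]
    have := norm_add_sq_eq_norm_sq_add_norm_sq_of_inner_eq_zero p (inner 𝕜 v u • v) hz
    rw [hp, sub_add_cancel, hu, norm_smul, hv, ← hp] at this
    nlinarith
  have hp1 : ‖p‖ ≤ 1 := by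
    nlinarith [norm_nonneg p, sq_nonneg ‖inner 𝕜 v u‖]
  have h1 := abs_le.mp (hν.abs_integral_weighted_sub_le (measurable_weight (𝕜 := 𝕜) ρ v)
    (abs_weight_le ρ v) (by norm_num : (0 : ℝ) < 2 / 2 ^ 13) hu.le hp1 hup)
  have h2 := hν.le_integral_weight_of_inner_eq_zero hρ hv hpv
  have h3 : ‖inner 𝕜 v u‖ ^ 2 ≤ (2 / 2 ^ 13) ^ 2 := by gcongr
  norm_num at h1 h3
  linarith [h1.1]

end IsCertifying

end Certificates

/-! ### From a net to all directions, and the union bound. -/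

section Empirical

variable {𝕜 : Type*} [RCLike 𝕜] {E : Type*} [NormedAddCommGroup E] [InnerProductSpace 𝕜 E] {m : ℕ}

/-- Empirical counterpart of `IsCertifying.abs_integral_weighted_sub_le`, with the upper frame bound
`B` in place of the second moment bound. -/
lemma abs_sum_weighted_sub_le {g : Fin m → E} {B : ℝ}
    (hB : ∀ x : E, ∑ i, ‖inner 𝕜 (g i) x‖ ^ 2 ≤ B * ‖x‖ ^ 2) (hB0 : 0 ≤ B) {f : Fin m → ℝ}
    (hf : ∀ i, |f i| ≤ 1) {δ : ℝ} (hδ : 0 < δ) {u w : E} (hu : ‖u‖ ≤ 1) (hw : ‖w‖ ≤ 1)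
    (huw : ‖u - w‖ ≤ δ) :
    |∑ i, f i * ‖inner 𝕜 (g i) u‖ ^ 2 - ∑ i, f i * ‖inner 𝕜 (g i) w‖ ^ 2| ≤ 5 / 2 * B * δ := by
  have hsum : ‖u + w‖ ≤ 2 := (norm_add_le u w).trans (by linarith)
  rw [← Finset.sum_sub_distrib]
  calc _ ≤ ∑ i, |f i * ‖inner 𝕜 (g i) u‖ ^ 2 - f i * ‖inner 𝕜 (g i) w‖ ^ 2| :=
        Finset.abs_sum_le_sum_abs _ _
    _ ≤ ∑ i, (‖inner 𝕜 (g i) (u - w)‖ ^ 2 / δ + δ * ‖inner 𝕜 (g i) (u + w)‖ ^ 2) / 2 := by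
        refine Finset.sum_le_sum fun i _ => ?_
        rw [← mul_sub, abs_mul]
        refine le_trans ?_ (abs_sq_inner_sub_sq_inner_le hδ (g i) u w)
        nlinarith [hf i, abs_nonneg (‖inner 𝕜 (g i) u‖ ^ 2 - ‖inner 𝕜 (g i) w‖ ^ 2)]
    _ = ((∑ i, ‖inner 𝕜 (g i) (u - w)‖ ^ 2) / δ + δ * ∑ i, ‖inner 𝕜 (g i) (u + w)‖ ^ 2) / 2 := by
        rw [← Finset.sum_div, Finset.sum_add_distrib, Finset.sum_div, Finset.mul_sum]
    _ ≤ (B * δ ^ 2 / δ + δ * (B * 2 ^ 2)) / 2 := by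
        gcongr
        · exact (hB _).trans (by gcongr)
        · exact (hB _).trans (by gcongr)
    _ = 5 / 2 * B * δ := by field_simp; ring

/-- A bound for the frame operator on a net of the sphere extends to the whole space. -/
lemma sum_sq_inner_le_of_net {N : Finset E}
    (hnet : ∀ x : E, ‖x‖ = 1 → ∃ y ∈ N, ‖x - y‖ ≤ 1 / 2 ^ 13) {g : Fin m → E}
    (hN : ∀ y ∈ N, ∑ i, ‖inner 𝕜 (g i) y‖ ^ 2 ≤ m * 8) (x : E) :
    ∑ i, ‖inner 𝕜 (g i) x‖ ^ 2 ≤ (16 * m) * ‖x‖ ^ 2 := by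
  let A : E →L[𝕜] EuclideanSpace 𝕜 (Fin m) :=
    (PiLp.continuousLinearEquiv 2 𝕜 fun _ : Fin m => 𝕜).symm.toContinuousLinearMap ∘L
      ContinuousLinearMap.pi fun i => innerSL 𝕜 (g i)
  have hA : ∀ x, ‖A x‖ ^ 2 = ∑ i, ‖inner 𝕜 (g i) x‖ ^ 2 := fun x => by
    rw [EuclideanSpace.norm_sq_eq]
    rfl
  -- The operator norm is bounded by its values on the net plus a small multiple of itself, which is
  -- then absorbed.
  have hT : ‖A‖ ≤ Real.sqrt (m * 8) + 1 / 2 ^ 13 * ‖A‖ := by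
    refine A.opNorm_le_bound (by positivity) fun x => ?_
    rcases eq_or_ne x 0 with rfl | hx
    · simp
    have hn : ‖x‖ ≠ 0 := norm_ne_zero_iff.mpr hx
    set z : E := ((‖x‖⁻¹ : ℝ) : 𝕜) • x with hz
    have hz1 : ‖z‖ = 1 := by
      rw [hz, norm_smul, RCLike.norm_ofReal, abs_of_nonneg (by positivity), inv_mul_cancel₀ hn]
    have hxz : ‖A x‖ = ‖A z‖ * ‖x‖ := by
      rw [hz, map_smul, norm_smul, RCLike.norm_ofReal, abs_of_nonneg (by positivity)]
      field_simp
    rw [hxz]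
    gcongr
    obtain ⟨y, hy, hzy⟩ := hnet z hz1
    have h1 : ‖A y‖ ≤ Real.sqrt (m * 8) := Real.le_sqrt_of_sq_le (by rw [hA]; exact hN y hy)
    have h2 : ‖A (z - y)‖ ≤ 1 / 2 ^ 13 * ‖A‖ :=
      (A.le_opNorm _).trans (by rw [mul_comm]; gcongr)
    calc ‖A z‖ = ‖A y + A (z - y)‖ := by rw [← map_add]; congr 2; abel
      _ ≤ _ := (norm_add_le _ _).trans (add_le_add h1 h2)
  have hA16 : ‖A‖ ^ 2 ≤ 16 * m := by
    have h0 := norm_nonneg A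
    have h1 : (1 - 1 / 2 ^ 13) * ‖A‖ ≤ Real.sqrt (m * 8) := by linarith
    have h2 : ((1 - 1 / 2 ^ 13) * ‖A‖) ^ 2 ≤ m * 8 := by
      have h3 : 0 ≤ (1 - 1 / 2 ^ 13) * ‖A‖ := mul_nonneg (by norm_num) h0
      calc _ ≤ Real.sqrt (m * 8) ^ 2 := by gcongr
        _ = _ := Real.sq_sqrt (by positivity)
    rw [mul_pow] at h2
    norm_num at h2
    linarith [sq_nonneg ‖A‖]
  rw [← hA]
  calc ‖A x‖ ^ 2 ≤ (‖A‖ * ‖x‖) ^ 2 := by gcongr; exact A.le_opNorm x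
    _ = ‖A‖ ^ 2 * ‖x‖ ^ 2 := mul_pow _ _ _
    _ ≤ _ := by gcongr

/-- Deterministic step: control of the weighted frame operators on a net yields certificates. -/
lemma hasCertificates_of_net {N : Finset E} (hN1 : ∀ x ∈ N, ‖x‖ = 1)
    (hnet : ∀ x : E, ‖x‖ = 1 → ∃ y ∈ N, ‖x - y‖ ≤ 1 / 2 ^ 13) {ρ : ℝ} {g : Fin m → E}
    (hT : ∀ y ∈ N, ∑ i, ‖inner 𝕜 (g i) y‖ ^ 2 ≤ m * 8)
    (hself : ∀ v ∈ N, ∑ i, weight 𝕜 ρ v (g i) * ‖inner 𝕜 (g i) v‖ ^ 2 ≤ m * -(3 / 64))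
    (horth : ∀ v ∈ N, ∀ u ∈ N, ‖inner 𝕜 v u‖ ≤ 2 / 2 ^ 13 →
      m * (1 / 32) ≤ ∑ i, weight 𝕜 ρ v (g i) * ‖inner 𝕜 (g i) u‖ ^ 2) :
    HasCertificates 𝕜 ρ (1 / 64) g := by
  have hB := sum_sq_inner_le_of_net hnet hT
  have hm : (0 : ℝ) ≤ m := Nat.cast_nonneg m
  intro v hv
  obtain ⟨v', hv', hvv'⟩ := hnet v hv
  -- Passing to net points costs `(5/2)(16m)/2^13 = 5m/1024`, less than the slack `m/64` between
  -- `1/32` and `1/64`.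
  have hlip := fun {u w : E} => abs_sum_weighted_sub_le (u := u) (w := w) hB (by positivity)
    (fun i => abs_weight_le (𝕜 := 𝕜) ρ v' (g i)) (by norm_num : (0 : ℝ) < 1 / 2 ^ 13)
  refine ⟨fun i => weight 𝕜 ρ v' (g i), fun i => abs_weight_le ρ v' (g i), fun i hi => ?_, ?_, ?_⟩
  · by_contra hlt
    exact hi (if_neg hlt)
  · have h1 := (abs_le.mp (hlip hv.le (hN1 v' hv').le hvv')).2
    have h2 := hself v' hv'
    norm_num at h1
    linarith
  · intro u hu hvu
    obtain ⟨u', hu', huu'⟩ := hnet u hu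
    have h1 := (abs_le.mp (hlip hu.le (hN1 u' hu').le huu')).1
    have hin : ‖inner 𝕜 v' u'‖ ≤ 2 / 2 ^ 13 := by
      have h3 : inner 𝕜 v' u' = -inner 𝕜 v' (u - u') - inner 𝕜 (v - v') u := by
        rw [inner_sub_right, inner_sub_left, hvu]; ring
      rw [h3]
      refine (norm_sub_le _ _).trans ?_
      rw [norm_neg]
      have h4 := norm_inner_le_norm (𝕜 := 𝕜) v' (u - u')
      have h5 := norm_inner_le_norm (𝕜 := 𝕜) (v - v') u
      rw [hN1 v' hv', one_mul] at h4
      rw [hu, mul_one] at h5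
      linarith
    have h2 := horth v' hv' u' hu' hin
    norm_num at h1
    linarith

variable [MeasurableSpace E] [BorelSpace E]

/-- Certificates exist with overwhelming probability. -/
theorem IsCertifying.pi_real_not_hasCertificates_le {ν : Measure E} [IsProbabilityMeasure ν]
    (hν : IsCertifying 𝕜 ν) {ρ : ℝ} (hρ : ν.real {a | ρ < ‖a‖ ^ 2} ≤ 1 / 2 ^ 14) {N : Finset E}
    (hN1 : ∀ x ∈ N, ‖x‖ = 1) (hnet : ∀ x : E, ‖x‖ = 1 → ∃ y ∈ N, ‖x - y‖ ≤ 1 / 2 ^ 13) (m : ℕ) :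
    (Measure.pi fun _ : Fin m => ν).real {g | ¬ HasCertificates 𝕜 ρ (1 / 64) g} ≤
      3 * (N.card : ℝ) ^ 2 * Real.exp (-(m / 2 ^ 22)) := by
  set μ := Measure.pi fun _ : Fin m => ν
  -- Deviation `t = 1/64` in the Bernstein bound gives the rate `t²/1024 = 2^(-22)`. The event `S₁`
  -- has the better rate `1`.
  set q := Real.exp (-((m : ℝ) / 2 ^ 22)) with hq
  have hm : (0 : ℝ) ≤ m := Nat.cast_nonneg m
  set S₁ := ⋃ y ∈ N, {g : Fin m → E | (m : ℝ) * 8 ≤ ∑ i, ‖inner 𝕜 (g i) y‖ ^ 2}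
  set S₂ := ⋃ v ∈ N, {g : Fin m → E |
    (m : ℝ) * (∫ a, weight 𝕜 ρ v a * ‖inner 𝕜 a v‖ ^ 2 ∂ν + 1 / 64) ≤
      ∑ i, weight 𝕜 ρ v (g i) * ‖inner 𝕜 (g i) v‖ ^ 2}
  set S₃ := ⋃ p ∈ N ×ˢ N, {g : Fin m → E |
    (m : ℝ) * (∫ a, -(weight 𝕜 ρ p.1 a * ‖inner 𝕜 a p.2‖ ^ 2) ∂ν + 1 / 64) ≤
      ∑ i, -(weight 𝕜 ρ p.1 (g i) * ‖inner 𝕜 (g i) p.2‖ ^ 2)}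
  have hsub : {g : Fin m → E | ¬ HasCertificates 𝕜 ρ (1 / 64) g} ⊆ S₁ ∪ S₂ ∪ S₃ := by
    intro g hg
    by_contra hgood
    refine hg ?_
    simp only [S₁, S₂, S₃, Set.mem_union, Set.mem_iUnion, Set.mem_ofPred_eq, not_or, not_exists,
      not_le, Finset.mem_product, Prod.forall, and_imp] at hgood
    obtain ⟨⟨h1, h2⟩, h3⟩ := hgood
    refine hasCertificates_of_net hN1 hnet (fun y hy => (h1 y hy).le) (fun v hv => ?_)
      (fun v hv u hu hvu => ?_)
    · refine (h2 v hv).le.trans ?_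
      gcongr
      linarith [hν.integral_weight_self_le hρ (hN1 v hv)]
    · have h4 := h3 v u hv hu
      rw [Finset.sum_neg_distrib, integral_neg] at h4
      have h5 := hν.le_integral_weight hρ (hN1 u hu) (hN1 v hv) hvu
      have h6 : (m : ℝ) * (3 / 64) ≤ m * ∫ a, weight 𝕜 ρ v a * ‖inner 𝕜 a u‖ ^ 2 ∂ν := by gcongr
      linarith
  have hbound : ∀ (u v : E), |weight 𝕜 ρ v u * ‖inner 𝕜 u v‖ ^ 2| ≤ ‖inner 𝕜 u v‖ ^ 2 := by
    intro u v
    rw [abs_mul, abs_of_nonneg (by positivity : 0 ≤ ‖inner 𝕜 u v‖ ^ 2)]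
    exact mul_le_of_le_one_left (by positivity) (abs_weight_le ρ v u)
  have hP1 : μ.real S₁ ≤ N.card * q := by
    refine (measureReal_biUnion_finset_le N _).trans ?_
    refine le_of_le_of_eq (Finset.sum_le_card_nsmul N _ q ?_) (nsmul_eq_mul _ _)
    intro y hy
    have h2 : ∫ x, Real.exp (1 / 4 * ‖inner 𝕜 x y‖ ^ 2) ∂ν ≤ Real.exp 1 := by
      simp_rw [one_div_mul_eq_div]
      exact (hν.integral_exp_le y (hN1 y hy)).trans (by linarith [Real.add_one_le_exp 1])
    refine (pi_real_sum_ge_le (Z := fun a => ‖inner 𝕜 a y‖ ^ 2) (by norm_num : (0 : ℝ) ≤ 1 / 4)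
      (by simp_rw [one_div_mul_eq_div]; exact hν.integrable_exp y (hN1 y hy)) h2).trans ?_
    rw [hq]
    gcongr
    linarith
  have hP2 : μ.real S₂ ≤ N.card * q := by
    refine (measureReal_biUnion_finset_le N _).trans ?_
    refine le_of_le_of_eq (Finset.sum_le_card_nsmul N _ q ?_) (nsmul_eq_mul _ _)
    intro v hv
    refine (pi_real_sum_ge_le_of_subexponential (Z := fun a => weight 𝕜 ρ v a * ‖inner 𝕜 a v‖ ^ 2)
      ((measurable_weight ρ v).mul (measurable_sq_inner 𝕜 v)) (fun a => hbound a v)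
      (hν.integrable_exp v (hN1 v hv)) (hν.integral_exp_le v (hN1 v hv))
      (by norm_num : (0 : ℝ) ≤ 1 / 64) (by norm_num)).trans (le_of_eq ?_)
    rw [hq]; congr 1; ring
  have hP3 : μ.real S₃ ≤ (N.card : ℝ) ^ 2 * q := by
    refine (measureReal_biUnion_finset_le (N ×ˢ N) _).trans ?_
    rw [sq, ← Nat.cast_mul, ← Finset.card_product]
    refine le_of_le_of_eq (Finset.sum_le_card_nsmul (N ×ˢ N) _ q ?_) (nsmul_eq_mul _ _)
    intro p hp
    have hp2 := hN1 p.2 (Finset.mem_product.mp hp).2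
    refine (pi_real_sum_ge_le_of_subexponential
      (Z := fun a => -(weight 𝕜 ρ p.1 a * ‖inner 𝕜 a p.2‖ ^ 2))
      ((measurable_weight ρ p.1).mul (measurable_sq_inner 𝕜 p.2)).neg (fun a => ?_)
      (hν.integrable_exp p.2 hp2) (hν.integral_exp_le p.2 hp2)
      (by norm_num : (0 : ℝ) ≤ 1 / 64) (by norm_num)).trans (le_of_eq ?_)
    · rw [abs_neg, abs_mul, abs_of_nonneg (by positivity : 0 ≤ ‖inner 𝕜 a p.2‖ ^ 2)]
      exact mul_le_of_le_one_left (by positivity) (abs_weight_le ρ p.1 a)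
    · rw [hq]; congr 1; ring
  have hcard : (N.card : ℝ) ≤ (N.card : ℝ) ^ 2 := by
    exact_mod_cast Nat.le_self_pow two_ne_zero N.card
  have hq0 : 0 ≤ q := (Real.exp_pos _).le
  have hcq : (N.card : ℝ) * q ≤ (N.card : ℝ) ^ 2 * q := by gcongr
  calc μ.real _ ≤ μ.real (S₁ ∪ S₂ ∪ S₃) := measureReal_mono hsub
    _ ≤ μ.real S₁ + μ.real S₂ + μ.real S₃ :=
        (measureReal_union_le _ _).trans (by gcongr; exact measureReal_union_le _ _)
    _ ≤ _ := by linarith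

end Empirical

/-! ### One-dimensional Gaussian integrals. -/

section OneDimensional

/-- An exponential-quadratic tilt of the standard normal law is a multiple of a normal law. -/
lemma integral_gaussianReal_exp_mul {v : NNReal} (hv : v ≠ 0) (F : ℝ → ℝ) :
    ∫ x, Real.exp ((1 / 2 - 1 / (2 * v)) * x ^ 2) * F x ∂gaussianReal 0 1 =
      Real.sqrt v * ∫ x, F x ∂gaussianReal 0 v := by
  rw [integral_gaussianReal_eq_integral_smul one_ne_zero, integral_gaussianReal_eq_integral_smul hv,
    ← integral_const_mul]
  refine integral_congr_ae (ae_of_all _ fun x => ?_)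
  have hv' : (0 : ℝ) < v := by exact_mod_cast pos_iff_ne_zero.mpr hv
  have hs : Real.sqrt v ≠ 0 := (Real.sqrt_pos.mpr hv').ne'
  simp only [gaussianPDFReal_def, smul_eq_mul, NNReal.coe_one, mul_one, sub_zero]
  rw [Real.sqrt_mul (by positivity) (v : ℝ), mul_inv]
  have hexp : Real.exp (-x ^ 2 / 2) * Real.exp ((1 / 2 - 1 / (2 * v)) * x ^ 2) =
      Real.exp (-x ^ 2 / (2 * v)) := by
    rw [← Real.exp_add]; congr 1; field_simp; ring
  rw [← hexp]
  field_simp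

lemma integral_gaussianReal_exp {v : NNReal} (hv : v ≠ 0) :
    ∫ x, Real.exp ((1 / 2 - 1 / (2 * v)) * x ^ 2) ∂gaussianReal 0 1 = Real.sqrt v := by
  have := integral_gaussianReal_exp_mul hv fun _ => 1
  simpa using this

lemma integral_gaussianReal_sq (v : NNReal) : ∫ x, x ^ 2 ∂gaussianReal 0 v = v := by
  have h := variance_id_gaussianReal (μ := 0) (v := v)
  rw [variance_of_integral_eq_zero (by fun_prop) (by simp)] at h
  simpa using h

lemma integral_gaussianReal_exp_mul_sq {v : NNReal} (hv : v ≠ 0) :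
    ∫ x, Real.exp ((1 / 2 - 1 / (2 * v)) * x ^ 2) * x ^ 2 ∂gaussianReal 0 1 = Real.sqrt v * v := by
  rw [integral_gaussianReal_exp_mul hv, integral_gaussianReal_sq]

/-- The Bochner integral of a non-integrable function is `0` by convention, so the nonzero value
just computed already gives integrability. -/
lemma integrable_gaussianReal_exp {v : NNReal} (hv : v ≠ 0) :
    Integrable (fun x => Real.exp ((1 / 2 - 1 / (2 * v)) * x ^ 2)) (gaussianReal 0 1) :=
  .of_integral_ne_zero <| by
    rw [integral_gaussianReal_exp hv, Real.sqrt_ne_zero']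
    exact_mod_cast pos_iff_ne_zero.mpr hv

lemma integrable_gaussianReal_exp_mul_sq {v : NNReal} (hv : v ≠ 0) :
    Integrable (fun x => Real.exp ((1 / 2 - 1 / (2 * v)) * x ^ 2) * x ^ 2) (gaussianReal 0 1) :=
  .of_integral_ne_zero <| by
    have : (0 : ℝ) < v := by exact_mod_cast pos_iff_ne_zero.mpr hv
    rw [integral_gaussianReal_exp_mul_sq hv]
    positivity

lemma integrable_gaussianReal_sq : Integrable (fun x => x ^ 2) (gaussianReal 0 1) :=
  .of_integral_ne_zero <| by rw [integral_gaussianReal_sq]; simp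

/-- The law of a squared marginal: the properties that make a rotation invariant law with
independent orthogonal marginals certifying. -/
structure IsMarginal (τ : Measure ℝ) : Prop where
  integrable_exp : Integrable (fun s => Real.exp (s / 4)) τ
  integral_exp_le : ∫ s, Real.exp (s / 4) ∂τ ≤ 2
  integrable_id : Integrable (fun s => s) τ
  integral_id : ∫ s, s ∂τ = 1
  integrable_exp_neg : Integrable (fun s => Real.exp (-s)) τ
  le_integral_exp_neg : 1 / 2 ≤ ∫ s, Real.exp (-s) ∂τ
  integrable_exp_neg_mul : Integrable (fun s => Real.exp (-s) * s) τ
  integral_exp_neg_mul_le : ∫ s, Real.exp (-s) * s ∂τ ≤ 1 / 4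

/-- The chi-squared law with one degree of freedom. -/
lemma isMarginal_sq : IsMarginal ((gaussianReal 0 1).map fun x => x ^ 2) := by
  have hm : AEMeasurable (fun x : ℝ => x ^ 2) (gaussianReal 0 1) := by fun_prop
  -- Variance `2` produces the tilt `exp(x²/4)` and variance `1/3` the tilt `exp(-x²)`; the
  -- resulting values are `√2`, `1/√3` and `1/(3√3)`.
  have h2 : ∀ x : ℝ, (1 / 2 - 1 / (2 * ((2 : NNReal) : ℝ))) * x ^ 2 = x ^ 2 / 4 := fun x => by
    push_cast; ring
  have h3 : ∀ x : ℝ, (1 / 2 - 1 / (2 * ((1 / 3 : NNReal) : ℝ))) * x ^ 2 = -x ^ 2 := fun x => by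
    push_cast; ring
  have hs3 : (1 / 2 : ℝ) ≤ Real.sqrt ((1 / 3 : NNReal) : ℝ) :=
    Real.le_sqrt_of_sq_le (by push_cast; norm_num)
  have hs3' : Real.sqrt ((1 / 3 : NNReal) : ℝ) ≤ 3 / 4 :=
    Real.sqrt_le_iff.mpr ⟨by norm_num, by push_cast; norm_num⟩
  have i2 := integrable_gaussianReal_exp (v := 2) (by norm_num)
  have e2 := integral_gaussianReal_exp (v := 2) (by norm_num)
  have i3 := integrable_gaussianReal_exp (v := 1 / 3) (by norm_num)
  have e3 := integral_gaussianReal_exp (v := 1 / 3) (by norm_num)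
  have j3 := integrable_gaussianReal_exp_mul_sq (v := 1 / 3) (by norm_num)
  have f3 := integral_gaussianReal_exp_mul_sq (v := 1 / 3) (by norm_num)
  simp_rw [h2] at i2 e2
  simp_rw [h3] at i3 e3 j3 f3
  constructor
  · rw [integrable_map_measure (by fun_prop) hm]; exact i2
  · rw [integral_map hm (by fun_prop), e2]
    exact Real.sqrt_le_iff.mpr ⟨by norm_num, by push_cast; norm_num⟩
  · rw [integrable_map_measure (by fun_prop) hm]; exact integrable_gaussianReal_sq
  · rw [integral_map hm (by fun_prop), integral_gaussianReal_sq]; simp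
  · rw [integrable_map_measure (by fun_prop) hm]; exact i3
  · rw [integral_map hm (by fun_prop), e3]; exact hs3
  · rw [integrable_map_measure (by fun_prop) hm]; exact j3
  · rw [integral_map hm (by fun_prop), f3]
    push_cast at hs3' ⊢
    linarith

/-- The law of `|z|²` for a standard complex normal variable `z`. -/
lemma isMarginal_half_sq_add_sq :
    IsMarginal (((gaussianReal 0 1).prod (gaussianReal 0 1)).map
      fun p => (p.1 ^ 2 + p.2 ^ 2) / 2) := by
  have hm : AEMeasurable (fun p : ℝ × ℝ => (p.1 ^ 2 + p.2 ^ 2) / 2)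
    ((gaussianReal 0 1).prod (gaussianReal 0 1)) := by fun_prop
  -- Each coordinate carries half of the exponent, so the variances are `4/3` and `1/2`. Here the
  -- bounds `1/2` and `1/4` are attained.
  have h2 : ∀ x : ℝ, (1 / 2 - 1 / (2 * ((4 / 3 : NNReal) : ℝ))) * x ^ 2 = x ^ 2 / 8 := fun x => by
    push_cast; ring
  have h3 : ∀ x : ℝ, (1 / 2 - 1 / (2 * ((1 / 2 : NNReal) : ℝ))) * x ^ 2 = -x ^ 2 / 2 := fun x => by
    push_cast; ring
  have i2 := integrable_gaussianReal_exp (v := 4 / 3) (by norm_num)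
  have e2 := integral_gaussianReal_exp (v := 4 / 3) (by norm_num)
  have i3 := integrable_gaussianReal_exp (v := 1 / 2) (by norm_num)
  have e3 := integral_gaussianReal_exp (v := 1 / 2) (by norm_num)
  have j3 := integrable_gaussianReal_exp_mul_sq (v := 1 / 2) (by norm_num)
  have f3 := integral_gaussianReal_exp_mul_sq (v := 1 / 2) (by norm_num)
  simp_rw [h2] at i2 e2
  simp_rw [h3] at i3 e3 j3 f3
  have k2 : ∀ p : ℝ × ℝ, Real.exp ((p.1 ^ 2 + p.2 ^ 2) / 2 / 4) =
      Real.exp (p.1 ^ 2 / 8) * Real.exp (p.2 ^ 2 / 8) := fun p => by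
    rw [← Real.exp_add]; congr 1; ring
  have k3 : ∀ p : ℝ × ℝ, Real.exp (-((p.1 ^ 2 + p.2 ^ 2) / 2)) =
      Real.exp (-p.1 ^ 2 / 2) * Real.exp (-p.2 ^ 2 / 2) := fun p => by
    rw [← Real.exp_add]; congr 1; ring
  have k4 : ∀ p : ℝ × ℝ, Real.exp (-((p.1 ^ 2 + p.2 ^ 2) / 2)) * ((p.1 ^ 2 + p.2 ^ 2) / 2) =
      1 / 2 * ((Real.exp (-p.1 ^ 2 / 2) * p.1 ^ 2) * Real.exp (-p.2 ^ 2 / 2)) +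
      1 / 2 * (Real.exp (-p.1 ^ 2 / 2) * (Real.exp (-p.2 ^ 2 / 2) * p.2 ^ 2)) := fun p => by
    rw [k3]; ring
  have k5 : ∀ p : ℝ × ℝ, (p.1 ^ 2 + p.2 ^ 2) / 2 =
      1 / 2 * (p.1 ^ 2 * (1 : ℝ)) + 1 / 2 * ((1 : ℝ) * p.2 ^ 2) := fun p => by ring
  have l1 := (integrable_gaussianReal_sq.mul_prod
    (integrable_const (μ := gaussianReal 0 1) (1 : ℝ))).const_mul (1 / 2)
  have l2 := ((integrable_const (μ := gaussianReal 0 1) (1 : ℝ)).mul_prod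
    integrable_gaussianReal_sq).const_mul (1 / 2)
  have l3 := (j3.mul_prod i3).const_mul (1 / 2)
  have l4 := (i3.mul_prod j3).const_mul (1 / 2)
  have hsq : Real.sqrt ((1 / 2 : NNReal) : ℝ) * Real.sqrt ((1 / 2 : NNReal) : ℝ) = 1 / 2 := by
    rw [Real.mul_self_sqrt (by positivity)]; norm_num
  constructor
  · rw [integrable_map_measure (by fun_prop) hm]
    simp only [Function.comp_def, k2]
    exact i2.mul_prod i2
  · rw [integral_map hm (by fun_prop)]
    simp_rw [k2]
    rw [integral_prod_mul (fun x => Real.exp (x ^ 2 / 8)) (fun x => Real.exp (x ^ 2 / 8)), e2,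
      Real.mul_self_sqrt (by positivity)]
    push_cast; norm_num
  · rw [integrable_map_measure (by fun_prop) hm]
    simp only [Function.comp_def, k5]
    exact l1.add l2
  · rw [integral_map hm (by fun_prop)]
    simp_rw [k5]
    rw [integral_add l1 l2, integral_const_mul, integral_const_mul,
      integral_prod_mul (fun x : ℝ => x ^ 2) (fun _ : ℝ => (1 : ℝ)),
      integral_prod_mul (fun _ : ℝ => (1 : ℝ)) (fun x : ℝ => x ^ 2), integral_gaussianReal_sq]
    simp
    norm_num
  · rw [integrable_map_measure (by fun_prop) hm]
    simp only [Function.comp_def, k3]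
    exact i3.mul_prod i3
  · rw [integral_map hm (by fun_prop)]
    simp_rw [k3]
    rw [integral_prod_mul (fun x => Real.exp (-x ^ 2 / 2)) (fun x => Real.exp (-x ^ 2 / 2)), e3,
      hsq]
  · rw [integrable_map_measure (by fun_prop) hm]
    simp only [Function.comp_def, k4]
    exact l3.add l4
  · rw [integral_map hm (by fun_prop)]
    simp_rw [k4]
    rw [integral_add l3 l4, integral_const_mul, integral_const_mul,
      integral_prod_mul (fun x => Real.exp (-x ^ 2 / 2) * x ^ 2) (fun x => Real.exp (-x ^ 2 / 2)),
      integral_prod_mul (fun x => Real.exp (-x ^ 2 / 2)) (fun x => Real.exp (-x ^ 2 / 2) * x ^ 2),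
      e3, f3, mul_right_comm, ← mul_assoc (Real.sqrt _), hsq]
    push_cast; norm_num

end OneDimensional

/-! ### Gaussian laws are certifying. -/

section Gaussian

/-- The constant `3/8` in the profile is the midpoint of `1/4` and `1/2`, which leaves the margin
`1/8` on both sides. In orthogonal directions the expectation factorizes by independence. -/
lemma IsMarginal.isCertifying {𝕜 : Type*} [RCLike 𝕜] {E : Type*} [NormedAddCommGroup E]
    [InnerProductSpace 𝕜 E] [MeasurableSpace E] [BorelSpace E] {ν : Measure E} {τ : Measure ℝ}
    [IsProbabilityMeasure τ] (hτ : IsMarginal τ)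
    (hmap : ∀ u : E, ‖u‖ = 1 → ν.map (fun a => ‖inner 𝕜 a u‖ ^ 2) = τ)
    (hind : ∀ u v : E, ‖u‖ = 1 → ‖v‖ = 1 → inner 𝕜 v u = 0 →
      IndepFun (fun a => ‖inner 𝕜 a v‖ ^ 2) (fun a => ‖inner 𝕜 a u‖ ^ 2) ν) :
    IsCertifying 𝕜 ν := by
  have hmeas := fun u : E => (measurable_sq_inner 𝕜 u).aemeasurable (μ := ν)
  have hinteg : ∀ {u : E}, ‖u‖ = 1 → ∀ F : ℝ → ℝ, Measurable F →
      ∫ a, F (‖inner 𝕜 a u‖ ^ 2) ∂ν = ∫ s, F s ∂τ := fun {u} hu F hF => by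
    rw [← hmap u hu, integral_map (hmeas u) hF.aestronglyMeasurable]
  refine ⟨fun u hu => ?_, fun u hu => ?_, fun v hv => ?_, fun u v hu hv huv => ?_⟩
  · have := hτ.integrable_exp
    rw [← hmap u hu, integrable_map_measure (by fun_prop) (hmeas u)] at this
    exact this
  · rw [hinteg hu (fun s => Real.exp (s / 4)) (by fun_prop)]
    exact hτ.integral_exp_le
  · rw [hinteg hv (fun s => profile s * s) (measurable_profile.mul measurable_id)]
    simp_rw [profile, sub_mul]
    rw [integral_sub hτ.integrable_exp_neg_mul (hτ.integrable_id.const_mul _), integral_const_mul,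
      hτ.integral_id]
    linarith [hτ.integral_exp_neg_mul_le]
  · have h := ((hind u v hu hv huv).comp measurable_profile measurable_id)
    have h' := h.integral_fun_mul_eq_mul_integral
      (measurable_profile.comp (measurable_sq_inner 𝕜 v)).aestronglyMeasurable
      (measurable_id.comp (measurable_sq_inner 𝕜 u)).aestronglyMeasurable
    simp only [Function.comp_apply, id_eq] at h'
    rw [h', hinteg hv profile measurable_profile, hinteg hu (fun s => s) measurable_id, hτ.integral_id,
      mul_one]
    simp_rw [profile]
    rw [integral_sub hτ.integrable_exp_neg (integrable_const _)]
    simp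
    linarith [hτ.le_integral_exp_neg]

section

variable {E : Type*} [NormedAddCommGroup E] [InnerProductSpace ℝ E] [FiniteDimensional ℝ E]
  [MeasurableSpace E] [BorelSpace E]

/-- The coordinates of a standard Gaussian vector in orthonormal directions are independent
standard normal variables. -/
lemma map_inner_stdGaussian {ι : Type*} [Fintype ι] {e : ι → E} (he : Orthonormal ℝ e) :
    (stdGaussian E).map (fun a i => inner ℝ (e i) a) = Measure.pi fun _ : ι => gaussianReal 0 1 := by
  have hL : Measurable fun a : E => (WithLp.toLp 2 fun i => inner ℝ (e i) a : EuclideanSpace ℝ ι) := by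
    fun_prop
  have hmap : (stdGaussian E).map
      (fun a => (WithLp.toLp 2 fun i => inner ℝ (e i) a : EuclideanSpace ℝ ι)) =
      stdGaussian (EuclideanSpace ℝ ι) := by
    have := Measure.isProbabilityMeasure_map (μ := stdGaussian E) hL.aemeasurable
    refine Measure.ext_of_charFun (funext fun t => ?_)
    rw [charFun_stdGaussian, charFun_apply, integral_map hL.aemeasurable (by fun_prop)]
    -- The characteristic function of the coordinates at `t` is that of the Gaussian at `∑ tᵢeᵢ`,
    -- which has the norm of `t`.
    have hin : ∀ a : E, inner ℝ (WithLp.toLp 2 fun i => inner ℝ (e i) a : EuclideanSpace ℝ ι) t =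
        inner ℝ a (∑ i, t i • e i) := fun a => by
      rw [inner_sum, PiLp.inner_apply]
      refine Finset.sum_congr rfl fun i _ => ?_
      rw [inner_smul_right, real_inner_comm (e i) a]
      simp [mul_comm]
    simp_rw [hin]
    rw [← charFun_apply, charFun_stdGaussian]
    congr 3
    norm_cast
    rw [EuclideanSpace.real_norm_sq_eq, ← real_inner_self_eq_norm_sq, he.inner_sum]
    simp [sq]
  rw [← map_pi_eq_stdGaussian] at hmap
  have h2 := congrArg (Measure.map (WithLp.ofLp (p := 2))) hmap
  rw [Measure.map_map (by fun_prop) hL, Measure.map_map (by fun_prop) (by fun_prop)] at h2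
  simpa [Function.comp_def] using h2

lemma map_inner_stdGaussian_eq_gaussianReal {u : E} (hu : ‖u‖ = 1) :
    (stdGaussian E).map (fun a => inner ℝ u a) = gaussianReal 0 1 := by
  have he : Orthonormal ℝ fun _ : Unit => u := ⟨fun _ => hu, fun i j h => absurd rfl h⟩
  have h := congrArg (Measure.map (Function.eval ())) (map_inner_stdGaussian he)
  rw [Measure.map_map (by fun_prop) (by fun_prop), Measure.pi_map_eval] at h
  simpa [Function.comp_def] using h

lemma iIndepFun_inner_stdGaussian {ι : Type*} [Fintype ι] {e : ι → E} (he : Orthonormal ℝ e) :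
    iIndepFun (fun i a => inner ℝ (e i) a) (stdGaussian E) := by
  rw [iIndepFun_iff_map_fun_eq_pi_map (fun i => by fun_prop), map_inner_stdGaussian he]
  simp_rw [map_inner_stdGaussian_eq_gaussianReal (he.1 _)]

lemma isCertifying_stdGaussian : IsCertifying ℝ (stdGaussian E) := by
  have hsq : ∀ u a : E, ‖inner ℝ a u‖ ^ 2 = inner ℝ u a ^ 2 := fun u a => by
    rw [Real.norm_eq_abs, sq_abs, real_inner_comm]
  have : IsProbabilityMeasure ((gaussianReal 0 1).map fun x : ℝ => x ^ 2) :=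
    Measure.isProbabilityMeasure_map (by fun_prop)
  refine isMarginal_sq.isCertifying (fun u hu => ?_) fun u v hu hv huv => ?_
  · simp_rw [hsq]
    rw [← map_inner_stdGaussian_eq_gaussianReal hu, Measure.map_map (by fun_prop) (by fun_prop)]
    rfl
  · simp_rw [hsq]
    have he : Orthonormal ℝ ![v, u] := by
      rw [orthonormal_iff_ite]
      simp [Fin.forall_fin_two, hu, hv, huv, real_inner_comm v u]
    have h := (iIndepFun_inner_stdGaussian he).indepFun (i := 0) (j := 1) (by decide)
    exact h.comp (φ := fun x => x ^ 2) (ψ := fun x => x ^ 2) (by fun_prop) (by fun_prop)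

end

section Complex

variable {E : Type*} [NormedAddCommGroup E] [InnerProductSpace ℂ E] [InnerProductSpace ℝ E]
  [FiniteDimensional ℝ E] [MeasurableSpace E] [BorelSpace E]

/-- The squared complex marginal along `u` is half the sum of the squared real coordinates along `u`
and `iu`. If `u` and `v` are complex orthogonal, then `v, iv, u, iu` are real orthonormal, so the
marginals are independent. -/
lemma isCertifying_complex_stdGaussian (hre : ∀ x y : E, inner ℝ x y = (inner ℂ x y).re) :
    IsCertifying ℂ ((stdGaussian E).map fun a => (((Real.sqrt 2)⁻¹ : ℝ) : ℂ) • a) := by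
  have hI : ∀ x y : E, inner ℝ (Complex.I • x) y = (inner ℂ x y).im := fun x y => by
    rw [hre, inner_smul_left]; simp
  have hsq : ∀ u a : E, ‖inner ℂ ((((Real.sqrt 2)⁻¹ : ℝ) : ℂ) • a) u‖ ^ 2 =
      (inner ℝ u a ^ 2 + inner ℝ (Complex.I • u) a ^ 2) / 2 := fun u a => by
    rw [inner_smul_left, norm_mul, mul_pow, hre, hI, ← inner_conj_symm a u, RCLike.norm_conj,
      RCLike.norm_conj, Complex.norm_real, Real.norm_eq_abs, sq_abs, inv_pow,
      Real.sq_sqrt zero_le_two, Complex.sq_norm, Complex.normSq_apply]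
    ring
  have hinI : ∀ x y : E, inner ℝ (Complex.I • x) (Complex.I • y) = inner ℝ x y := fun x y => by
    rw [hre, hre, inner_smul_left, inner_smul_right]; simp
  have hxI : ∀ x : E, inner ℝ x (Complex.I • x) = 0 := fun x => by
    rw [hre, inner_smul_right, inner_self_eq_norm_sq_to_K]; simp [← Complex.ofReal_pow]
  have hnI : ∀ x : E, ‖Complex.I • x‖ = ‖x‖ := fun x => by rw [norm_smul]; simp
  have hc : Measurable fun a : E => (((Real.sqrt 2)⁻¹ : ℝ) : ℂ) • a :=
    (continuous_const_smul _).measurable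
  have : IsProbabilityMeasure (((gaussianReal 0 1).prod (gaussianReal 0 1)).map
      fun p : ℝ × ℝ => (p.1 ^ 2 + p.2 ^ 2) / 2) :=
    Measure.isProbabilityMeasure_map (by fun_prop)
  refine isMarginal_half_sq_add_sq.isCertifying (fun u hu => ?_) fun u v hu hv huv => ?_
  · rw [Measure.map_map (measurable_sq_inner ℂ u) hc]
    simp only [Function.comp_def, hsq]
    have he : Orthonormal ℝ ![u, Complex.I • u] := by
      rw [orthonormal_iff_ite]
      simp [Fin.forall_fin_two, hu, hnI, hxI, real_inner_comm u (Complex.I • u)]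
    have h := (iIndepFun_inner_stdGaussian he).indepFun (i := 0) (j := 1) (by decide)
    rw [indepFun_iff_map_prod_eq_prod_map_map (by fun_prop) (by fun_prop)] at h
    simp only [Matrix.cons_val_zero, Matrix.cons_val_one] at h
    rw [map_inner_stdGaussian_eq_gaussianReal hu,
      map_inner_stdGaussian_eq_gaussianReal ((hnI u).trans hu)] at h
    rw [← h, Measure.map_map (by fun_prop) (by fun_prop)]
    rfl
  · have huv' : inner ℝ v u = 0 := by rw [hre, huv]; simp
    have huI : inner ℝ (Complex.I • v) u = 0 := by rw [hI, huv]; simp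
    have hvI : inner ℝ v (Complex.I • u) = 0 := by rw [hre, inner_smul_right, huv]; simp
    have he : Orthonormal ℝ ![v, Complex.I • v, u, Complex.I • u] := by
      rw [orthonormal_iff_ite]
      have h1 := real_inner_comm v (Complex.I • v)
      have h2 := real_inner_comm u (Complex.I • u)
      have h3 := real_inner_comm v u
      have h4 := real_inner_comm (Complex.I • v) u
      have h5 := real_inner_comm v (Complex.I • u)
      rw [hxI] at h1 h2
      rw [huv'] at h3
      rw [huI] at h4
      rw [hvI] at h5
      intro i j
      fin_cases i <;> fin_cases j <;>
        simp [hu, hv, hnI, hxI, hinI, huv', huI, hvI, h1, h2, h3, h4, h5]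
    have h := (iIndepFun_inner_stdGaussian he).indepFun_prodMk_prodMk (fun i => by fun_prop)
      0 1 2 3 (by decide) (by decide) (by decide) (by decide)
    have h' := h.comp (φ := fun p : ℝ × ℝ => (p.1 ^ 2 + p.2 ^ 2) / 2)
      (ψ := fun p : ℝ × ℝ => (p.1 ^ 2 + p.2 ^ 2) / 2) (by fun_prop) (by fun_prop)
    have := Measure.isProbabilityMeasure_map (μ := stdGaussian E) hc.aemeasurable
    have hv' := measurable_sq_inner ℂ v
    have hu' := measurable_sq_inner ℂ u
    rw [indepFun_iff_map_prod_eq_prod_map_map (by fun_prop) (by fun_prop)] at h' ⊢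
    rw [Measure.map_map (hv'.prodMk hu') hc, Measure.map_map hv' hc, Measure.map_map hu' hc]
    simp only [Function.comp_def, hsq]
    exact h'

end Complex

/-- The complex normal law is a rescaled standard Gaussian law of the underlying real space. -/
lemma complexGaussianModel_eq_map_stdGaussian (n : ℕ) :
    complexGaussianModel n = (stdGaussian (EuclideanSpace ℂ (Fin n))).map
      fun a => (((Real.sqrt 2)⁻¹ : ℝ) : ℂ) • a := by
  have hm : Measurable fun p : (Fin n → ℝ) × (Fin n → ℝ) =>
      (WithLp.toLp 2 fun j => (p.1 j : ℂ) + Complex.I * (p.2 j : ℂ) : EuclideanSpace ℂ (Fin n)) := by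
    fun_prop
  have hc : Measurable fun a : EuclideanSpace ℂ (Fin n) => (((Real.sqrt 2)⁻¹ : ℝ) : ℂ) • a :=
    (continuous_const_smul _).measurable
  have : IsProbabilityMeasure (complexGaussianModel n) :=
    Measure.isProbabilityMeasure_map hm.aemeasurable
  have := Measure.isProbabilityMeasure_map (μ := stdGaussian (EuclideanSpace ℂ (Fin n)))
    hc.aemeasurable
  refine Measure.ext_of_charFun (funext fun t => ?_)
  have hreal : (fun a : EuclideanSpace ℂ (Fin n) => (((Real.sqrt 2)⁻¹ : ℝ) : ℂ) • a) =
      fun a => (Real.sqrt 2)⁻¹ • a := funext fun a => by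
    ext j; simp
  rw [hreal, charFun_map_smul, charFun_stdGaussian, charFun_apply, complexGaussianModel,
    integral_map hm.aemeasurable (by fun_prop)]
  have hin : ∀ p : (Fin n → ℝ) × (Fin n → ℝ), Complex.exp ((inner ℝ
      (WithLp.toLp 2 fun j => (p.1 j : ℂ) + Complex.I * (p.2 j : ℂ) : EuclideanSpace ℂ (Fin n)) t : ℝ)
        * Complex.I) =
      (∏ j, Complex.exp ((t j).re * p.1 j * Complex.I)) *
        ∏ j, Complex.exp ((t j).im * p.2 j * Complex.I) := fun p => by
    rw [← Complex.exp_sum, ← Complex.exp_sum, ← Complex.exp_add, ← Finset.sum_add_distrib,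
      PiLp.inner_apply]
    congr 1
    push_cast
    rw [Finset.sum_mul]
    refine Finset.sum_congr rfl fun j _ => ?_
    simp [Complex.inner]
    ring
  simp_rw [hin]
  rw [integral_prod_mul (fun x : Fin n → ℝ => ∏ j, Complex.exp ((t j).re * x j * Complex.I))
      (fun y : Fin n → ℝ => ∏ j, Complex.exp ((t j).im * y j * Complex.I)),
    integral_fintype_prod_eq_prod (f := fun j (x : ℝ) => Complex.exp ((t j).re * x * Complex.I)),
    integral_fintype_prod_eq_prod (f := fun j (x : ℝ) => Complex.exp ((t j).im * x * Complex.I))]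
  simp_rw [← charFun_apply_real, charFun_gaussianReal]
  rw [← Complex.exp_sum, ← Complex.exp_sum, ← Complex.exp_add, ← Finset.sum_add_distrib]
  congr 1
  have hnorm : ‖(Real.sqrt 2)⁻¹ • t‖ ^ 2 = ∑ j, ((t j).re ^ 2 + (t j).im ^ 2) / 2 := by
    rw [norm_smul, mul_pow, EuclideanSpace.norm_sq_eq, Real.norm_eq_abs, sq_abs, inv_pow,
      Real.sq_sqrt zero_le_two, Finset.mul_sum]
    refine Finset.sum_congr rfl fun j _ => ?_
    rw [Complex.sq_norm, Complex.normSq_apply]; ring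
  rw [← Complex.ofReal_pow, hnorm]
  push_cast
  rw [← Finset.sum_neg_distrib, Finset.sum_div]
  refine Finset.sum_congr rfl fun j _ => ?_
  ring

end Gaussian

/-! ### The uniform law on the sphere as a normalized Gaussian law. -/

section Sphere

variable {E : Type*} [NormedAddCommGroup E] [InnerProductSpace ℝ E] [FiniteDimensional ℝ E]
  [MeasurableSpace E] [BorelSpace E]

/-- The standard Gaussian law has a radial density. -/
lemma exists_radial_density_stdGaussian :
    ∃ h : ℝ → ENNReal, Measurable h ∧
      stdGaussian E = (Measure.addHaar : Measure E).withDensity fun x => h ‖x‖ := by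
  set Z : ℝ := ∫ x : E, Real.exp (-(1 / 2) * ‖x‖ ^ 2) with hZ
  have hZval : Z = (Real.pi / (1 / 2)) ^ (Module.finrank ℝ E / 2 : ℝ) :=
    GaussianFourier.integral_rexp_neg_mul_sq_norm (by norm_num)
  have hZpos : 0 < Z := by rw [hZval]; positivity
  set k : ℝ → ENNReal := fun r => ENNReal.ofReal (Z⁻¹ * Real.exp (-(1 / 2) * r ^ 2)) with hk
  have hkm : Measurable k := by fun_prop
  have hkn : Measurable fun x : E => k ‖x‖ := hkm.comp measurable_norm
  have hinteg : Integrable (fun x : E => Z⁻¹ * Real.exp (-(1 / 2) * ‖x‖ ^ 2)) :=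
    (Integrable.of_integral_ne_zero hZpos.ne').const_mul _
  have hfin : IsFiniteMeasure ((volume : Measure E).withDensity fun x => k ‖x‖) :=
    isFiniteMeasure_withDensity_ofReal hinteg.2
  have hvol : stdGaussian E = (volume : Measure E).withDensity fun x => k ‖x‖ := by
    refine Measure.ext_of_charFun (funext fun t => ?_)
    rw [charFun_stdGaussian, charFun_apply, integral_withDensity_eq_integral_toReal_smul
      hkn (ae_of_all _ fun x => ENNReal.ofReal_lt_top)]
    have hpt : ∀ x : E, (k ‖x‖).toReal • Complex.exp ((inner ℝ x t : ℝ) * Complex.I) =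
        ((Z⁻¹ : ℝ) : ℂ) * Complex.exp (-(1 / 2 : ℂ) * (‖x‖ : ℂ) ^ 2 +
          Complex.I * (inner ℝ t x : ℝ)) := fun x => by
      rw [hk, ENNReal.toReal_ofReal (by positivity), Complex.real_smul, Complex.exp_add,
        real_inner_comm]
      push_cast
      rw [mul_comm Complex.I]
      ring
    simp_rw [hpt]
    rw [integral_const_mul, GaussianFourier.integral_cexp_neg_mul_sq_norm_add (by norm_num)]
    have hZc : ((Real.pi : ℂ) / (1 / 2)) ^ (Module.finrank ℝ E / 2 : ℂ) = (Z : ℂ) := by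
      rw [hZval, Complex.ofReal_cpow (by positivity)]
      push_cast; rfl
    rw [hZc, Complex.I_sq, ← mul_assoc, ← Complex.ofReal_mul, inv_mul_cancel₀ hZpos.ne',
      Complex.ofReal_one, one_mul]
    congr 1
    ring
  set c := (volume : Measure E).addHaarScalarFactor Measure.addHaar
  have hc : (volume : Measure E) = c • Measure.addHaar :=
    Measure.isAddLeftInvariant_eq_smul volume Measure.addHaar
  refine ⟨(c : ENNReal) • k, hkm.const_smul _, ?_⟩
  rw [hvol, hc, show (fun x : E => ((c : ENNReal) • k) ‖x‖) = (c : ENNReal) • fun x => k ‖x‖ from rfl,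
    withDensity_smul _ hkn, ← withDensity_smul_measure]
  rfl

/-- The direction of a standard Gaussian vector is uniform on the sphere. -/
lemma map_normalize_stdGaussian [Nontrivial E] (r : ℝ) :
    (stdGaussian E).map (fun x => r • ‖x‖⁻¹ • x) = uniformSphere E r := by
  obtain ⟨h, hh, hdens⟩ := exists_radial_density_stdGaussian (E := E)
  set μ : Measure E := Measure.addHaar
  have hN : Measurable fun x : E => r • ‖x‖⁻¹ • x := by fun_prop
  have hS : Measurable fun v : Metric.sphere (0 : E) 1 => r • (v : E) := by fun_prop
  set q := ∫⁻ t : Set.Ioi (0 : ℝ), h t ∂Measure.volumeIoiPow (Module.finrank ℝ E - 1)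
  -- In polar coordinates the radial density separates: the radial integral is a constant `q`, later
  -- fixed by total mass one.
  have hpolar : ∀ A : Set E, MeasurableSet A → (stdGaussian E).map (fun x => r • ‖x‖⁻¹ • x) A =
      μ.toSphere ((fun v : Metric.sphere (0 : E) 1 => r • (v : E)) ⁻¹' A) * q := by
    intro A hA
    set G : Metric.sphere (0 : E) 1 × Set.Ioi (0 : ℝ) → ENNReal := fun p =>
      Set.indicator ((fun v : Metric.sphere (0 : E) 1 => r • (v : E)) ⁻¹' A) 1 p.1 * h p.2 with hG
    have hind : Measurable
        (Set.indicator ((fun v : Metric.sphere (0 : E) 1 => r • (v : E)) ⁻¹' A)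
          (1 : Metric.sphere (0 : E) 1 → ENNReal)) := measurable_one.indicator (hS hA)
    have hGm : Measurable G := (hind.comp measurable_fst).mul
      (hh.comp (measurable_subtype_coe.comp measurable_snd))
    rw [Measure.map_apply hN hA, hdens, withDensity_apply _ (hN hA), ← lintegral_indicator (hN hA)]
    conv_lhs => rw [← restrict_compl_singleton (μ := μ) 0,
      ← lintegral_subtype_comap (measurableSet_singleton (0 : E)).compl]
    have hpt : ∀ x : ({0}ᶜ : Set E), Set.indicator ((fun x : E => r • ‖x‖⁻¹ • x) ⁻¹' A)
        (fun x => h ‖x‖) (x : E) = G (homeomorphUnitSphereProd E x) := fun x => by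
      by_cases hx : r • ‖(x : E)‖⁻¹ • (x : E) ∈ A
      · simp [hG, Set.indicator, hx]
      · simp [hG, Set.indicator, hx]
    simp_rw [hpt]
    rw [(μ.measurePreserving_homeomorphUnitSphereProd).lintegral_comp hGm]
    refine (lintegral_prod_mul hind.aemeasurable
      (hh.comp measurable_subtype_coe).aemeasurable).trans ?_
    rw [lintegral_indicator_one (hS hA)]
    rfl
  have huniv := hpolar Set.univ MeasurableSet.univ
  rw [Measure.map_apply hN MeasurableSet.univ, Set.preimage_univ, Set.preimage_univ, measure_univ]
    at huniv
  have hq : q = (μ.toSphere Set.univ)⁻¹ :=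
    ENNReal.eq_inv_of_mul_eq_one_left (by rw [mul_comm]; exact huniv.symm)
  ext A hA
  rw [hpolar A hA, uniformSphere, Measure.map_apply hS hA, Measure.smul_apply, smul_eq_mul, hq,
    mul_comm]

end Sphere

/-! ### Failure probability for rescaled certifying laws. -/

section Recovery

variable {𝕜 : Type*} [RCLike 𝕜] {n m : ℕ}

/-- Supplies measurability of the failure event, which is defined through uncountably many
conditions, so that its probability can be computed from the joint law. -/
lemma isClosed_lowerIsometry (c : ℝ) :
    IsClosed {a : Fin m → EuclideanSpace 𝕜 (Fin n) | LowerIsometry c a} := by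
  have : {a : Fin m → EuclideanSpace 𝕜 (Fin n) | LowerIsometry c a} =
      ⋂ (x₀ : EuclideanSpace 𝕜 (Fin n)) (X : Matrix (Fin n) (Fin n) 𝕜) (_ : X.PosSemidef),
        {a | c * m * frobeniusNorm (X - outer x₀) ≤
          ∑ i, ‖(outer (a i) * (X - outer x₀)).trace‖} := by
    ext a; simp [LowerIsometry]
  rw [this]
  refine isClosed_iInter fun x₀ => isClosed_iInter fun X => isClosed_iInter fun _ =>
    isClosed_le continuous_const (continuous_finsetSum _ fun i _ => ?_)
  simp_rw [trace_outer_mul_eq_inner]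
  have h : Continuous fun y : EuclideanSpace 𝕜 (Fin n) =>
      (WithLp.toLp 2 ((X - outer x₀).mulVec y.ofLp) : EuclideanSpace 𝕜 (Fin n)) :=
    (PiLp.continuous_toLp 2 _).comp (Continuous.matrix_mulVec continuous_const
      (PiLp.continuous_ofLp 2 _))
  exact ((continuous_apply i).inner (h.comp (continuous_apply i))).norm

variable [MeasurableSpace (EuclideanSpace 𝕜 (Fin n))] [BorelSpace (EuclideanSpace 𝕜 (Fin n))]

/-- Markov's inequality with `E‖a‖² ≤ 8n`. -/
lemma IsCertifying.real_norm_sq_gt_le {ν : Measure (EuclideanSpace 𝕜 (Fin n))}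
    [IsProbabilityMeasure ν] (hν : IsCertifying 𝕜 ν) (hn : 1 ≤ n) :
    ν.real {a | 2 ^ 17 * (n : ℝ) < ‖a‖ ^ 2} ≤ 1 / 2 ^ 14 := by
  let e := EuclideanSpace.basisFun (Fin n) 𝕜
  have hsum : ∀ a : EuclideanSpace 𝕜 (Fin n), ‖a‖ ^ 2 = ∑ j, ‖inner 𝕜 a (e j)‖ ^ 2 := fun a =>
    (e.sum_sq_norm_inner_left a).symm
  have hinteg : Integrable (fun a : EuclideanSpace 𝕜 (Fin n) => ‖a‖ ^ 2) ν := by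
    simp_rw [hsum]
    exact integrable_finsetSum _ fun j _ => hν.integrable_sq_inner (e j)
  have hle : ∫ a, ‖a‖ ^ 2 ∂ν ≤ 8 * n := by
    simp_rw [hsum]
    rw [integral_finsetSum _ fun j _ => hν.integrable_sq_inner (e j)]
    calc _ ≤ ∑ _j : Fin n, (8 : ℝ) := Finset.sum_le_sum fun j _ =>
          hν.integral_sq_inner_le_of_norm_eq_one (e.norm_eq_one j)
      _ = 8 * n := by simp [mul_comm]
  have hmarkov := mul_meas_ge_le_integral_of_nonneg (ae_of_all ν fun a => sq_nonneg ‖a‖) hinteg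
    (2 ^ 17 * (n : ℝ))
  have hmono : ν.real {a | 2 ^ 17 * (n : ℝ) < ‖a‖ ^ 2} ≤ ν.real {a | 2 ^ 17 * (n : ℝ) ≤ ‖a‖ ^ 2} :=
    measureReal_mono (Set.ofPred_subset_ofPred.mpr fun a ha => le_of_lt ha)
  have hn' : (0 : ℝ) < n := by exact_mod_cast hn
  have h1 : (2 ^ 17 * (n : ℝ)) * ν.real {a | 2 ^ 17 * (n : ℝ) < ‖a‖ ^ 2} ≤
      (2 ^ 17 * (n : ℝ)) * (1 / 2 ^ 14) :=
    (mul_le_mul_of_nonneg_left hmono (by positivity)).trans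
      (hmarkov.trans (hle.trans (le_of_eq (by ring))))
  exact le_of_mul_le_mul_left h1 (by positivity)

/-- The lower isometry constant. -/
noncomputable def isometryConst : ℝ := 1 / 64 / 2 ^ 17

/-- Stable recovery with overwhelming probability, for measurements whose law is the image of a
certifying law under a rescaling map. -/
theorem IsCertifying.measure_not_stableRecovery_le {ν : Measure (EuclideanSpace 𝕜 (Fin n))}
    [IsProbabilityMeasure ν] (hν : IsCertifying 𝕜 ν) (hn : 1 ≤ n)
    (hm : 2 ^ 25 * 16385 * (n : ℝ) ≤ m) {N : Finset (EuclideanSpace 𝕜 (Fin n))}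
    (hN1 : ∀ x ∈ N, ‖x‖ = 1)
    (hnet : ∀ x : EuclideanSpace 𝕜 (Fin n), ‖x‖ = 1 → ∃ y ∈ N, ‖x - y‖ ≤ 1 / 2 ^ 13)
    (hcard : (N.card : ℝ) ≤ 16385 ^ (2 * n))
    {T : EuclideanSpace 𝕜 (Fin n) → EuclideanSpace 𝕜 (Fin n)} (hT : Measurable T)
    (hscale : ∀ g, ∃ t : ℝ, 0 ≤ t ∧ (‖g‖ ^ 2 ≤ 2 ^ 17 * n → t ≤ 2 ^ 17) ∧
      ∀ u, ‖inner 𝕜 g u‖ ^ 2 = t * ‖inner 𝕜 (T g) u‖ ^ 2)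
    {Ω : Type*} [MeasurableSpace Ω] {P : Measure Ω} [IsProbabilityMeasure P]
    {a : Fin m → Ω → EuclideanSpace 𝕜 (Fin n)} (ha : IsIID a (ν.map T) P) :
    P {ω | ¬ StableRecovery (6 * (2 / isometryConst + 1)) (4 / isometryConst) fun i => a i ω} ≤
      ENNReal.ofReal (3 * Real.exp (-(1 / 2 ^ 23) * m)) := by
  have hn' : (1 : ℝ) ≤ n := by exact_mod_cast hn
  have hm0 : 0 < m := by
    have : (0 : ℝ) < m := by linarith
    exact_mod_cast this
  have hc : 0 < isometryConst := by unfold isometryConst; positivity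
  set bad := {b : Fin m → EuclideanSpace 𝕜 (Fin n) | ¬ LowerIsometry isometryConst b}
  have hbad : MeasurableSet bad := (isClosed_lowerIsometry isometryConst).measurableSet.compl
  have hTp : IsProbabilityMeasure (ν.map T) := Measure.isProbabilityMeasure_map hT.aemeasurable
  have hmeas : ∀ i, AEMeasurable (a i) P := fun i => (ha.law i).aemeasurable
  have hjoint : P.map (fun ω i => a i ω) = (Measure.pi fun _ : Fin m => ν).map fun g i => T (g i) := by
    rw [(iIndepFun_iff_map_fun_eq_pi_map hmeas).mp ha.indep,
      Measure.pi_map_pi (f := fun _ => T) fun _ => hT.aemeasurable]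
    congr 1
    exact funext fun i => (ha.law i).map_eq
  have hTm : Measurable fun (g : Fin m → EuclideanSpace 𝕜 (Fin n)) i => T (g i) := by fun_prop
  calc _ ≤ P ((fun ω i => a i ω) ⁻¹' bad) :=
        measure_mono (Set.ofPred_subset_ofPred.mpr fun ω hω hLI =>
          hω (LowerIsometry.stableRecovery hc hm0 hLI))
    _ ≤ P.map (fun ω i => a i ω) bad :=
        Measure.le_map_apply (aemeasurable_pi_lambda _ hmeas) bad
    _ = (Measure.pi fun _ : Fin m => ν) ((fun g i => T (g i)) ⁻¹' bad) := by
        rw [hjoint, Measure.map_apply hTm hbad]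
    _ ≤ (Measure.pi fun _ : Fin m => ν) {g | ¬ HasCertificates 𝕜 (2 ^ 17 * n) (1 / 64) g} :=
        measure_mono fun g hg hcert =>
          hg (hcert.lowerIsometry (by norm_num) (by norm_num) fun i => hscale (g i))
    _ ≤ ENNReal.ofReal (3 * (N.card : ℝ) ^ 2 * Real.exp (-(m / 2 ^ 22))) := by
        rw [← ofReal_measureReal]
        exact ENNReal.ofReal_le_ofReal
          (hν.pi_real_not_hasCertificates_le (hν.real_norm_sq_gt_le hn) hN1 hnet m)
    _ ≤ _ := by
        refine ENNReal.ofReal_le_ofReal ?_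
        -- The crude bound `16385 ≤ exp 16385` suffices: `m ≥ 2^25 · 16385 n` gives `4 · 16385 n ≤
        -- m/2^23`, half of the available exponent.
        have h1 : (N.card : ℝ) ^ 2 ≤ Real.exp (4 * n * 16385) := by
          calc (N.card : ℝ) ^ 2 ≤ (16385 ^ (2 * n)) ^ 2 := by gcongr
            _ = (16385 : ℝ) ^ (4 * n) := by rw [← pow_mul]; congr 1; ring
            _ ≤ Real.exp 16385 ^ (4 * n) := by
                gcongr
                linarith [Real.add_one_le_exp (16385 : ℝ)]
            _ = _ := by rw [← Real.exp_nat_mul]; push_cast; rfl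
        calc 3 * (N.card : ℝ) ^ 2 * Real.exp (-(m / 2 ^ 22))
            ≤ 3 * Real.exp (4 * n * 16385) * Real.exp (-(m / 2 ^ 22)) := by gcongr
          _ = 3 * Real.exp (4 * n * 16385 + -(m / 2 ^ 22)) := by rw [mul_assoc, ← Real.exp_add]
          _ ≤ _ := by
              gcongr
              linarith

end Recovery

/-! ### The four models. -/

section Models

variable {n : ℕ}

/-- The exponent `2n` accommodates both `ℝⁿ` and `ℂⁿ`, the latter of real dimension `2n`. -/
lemma exists_net_of_finrank_le {E : Type*} [NormedAddCommGroup E] [NormedSpace ℝ E]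
    [FiniteDimensional ℝ E] (hE : Module.finrank ℝ E ≤ 2 * n) :
    ∃ N : Finset E, (∀ x ∈ N, ‖x‖ = 1) ∧ (∀ x : E, ‖x‖ = 1 → ∃ y ∈ N, ‖x - y‖ ≤ 1 / 2 ^ 13) ∧
      (N.card : ℝ) ≤ 16385 ^ (2 * n) := by
  obtain ⟨N, h1, h2, h3⟩ := exists_sphere_net E (by norm_num : (0 : ℝ) < 1 / 2 ^ 13)
  refine ⟨N, h1, h2, h3.trans ?_⟩
  rw [show (1 : ℝ) + 2 / (1 / 2 ^ 13) = 16385 by norm_num]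
  exact pow_le_pow_right₀ (by norm_num) hE

/-- Normalization to a sphere rescales the measurements by a controlled factor. -/
lemma exists_scale_normalize {𝕜 : Type*} [RCLike 𝕜] {E : Type*} [NormedAddCommGroup E]
    [InnerProductSpace 𝕜 E] [Module ℝ E] [IsScalarTower ℝ 𝕜 E] (hn : 1 ≤ n) (g : E) :
    ∃ t : ℝ, 0 ≤ t ∧ (‖g‖ ^ 2 ≤ 2 ^ 17 * n → t ≤ 2 ^ 17) ∧
      ∀ u : E, ‖inner 𝕜 g u‖ ^ 2 = t * ‖inner 𝕜 (Real.sqrt n • ‖g‖⁻¹ • g) u‖ ^ 2 := by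
  have hn' : (0 : ℝ) < n := by exact_mod_cast hn
  refine ⟨‖g‖ ^ 2 / n, by positivity, fun h => by rwa [div_le_iff₀ hn'], fun u => ?_⟩
  rcases eq_or_ne g 0 with rfl | hg
  · simp
  have hg' : ‖g‖ ≠ 0 := norm_ne_zero_iff.mpr hg
  rw [RCLike.real_smul_eq_coe_smul (K := 𝕜), RCLike.real_smul_eq_coe_smul (K := 𝕜) ‖g‖⁻¹,
    inner_smul_left, inner_smul_left, norm_mul, norm_mul, RCLike.norm_conj, RCLike.norm_conj,
    RCLike.norm_ofReal, RCLike.norm_ofReal, abs_of_nonneg (Real.sqrt_nonneg _),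
    abs_of_nonneg (by positivity), mul_pow, mul_pow, Real.sq_sqrt hn'.le]
  field_simp

lemma exists_scale_id {𝕜 : Type*} [RCLike 𝕜] {E : Type*} [NormedAddCommGroup E]
    [InnerProductSpace 𝕜 E] (n : ℕ) (g : E) :
    ∃ t : ℝ, 0 ≤ t ∧ (‖g‖ ^ 2 ≤ 2 ^ 17 * n → t ≤ 2 ^ 17) ∧
      ∀ u : E, ‖inner 𝕜 g u‖ ^ 2 = t * ‖inner 𝕜 (id g) u‖ ^ 2 :=
  ⟨1, zero_le_one, fun _ => by norm_num, fun u => by simp⟩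

instance isProbabilityMeasure_complexGaussianModel (n : ℕ) :
    IsProbabilityMeasure (complexGaussianModel n) := by
  rw [complexGaussianModel_eq_map_stdGaussian]
  exact Measure.isProbabilityMeasure_map (continuous_const_smul _).aemeasurable

lemma isCertifying_complexGaussianModel (n : ℕ) : IsCertifying ℂ (complexGaussianModel n) := by
  rw [complexGaussianModel_eq_map_stdGaussian]
  exact isCertifying_complex_stdGaussian fun x y => by simp [PiLp.inner_apply]

lemma realUniformModel_eq_map (hn : 1 ≤ n) :
    realUniformModel n = (stdGaussian (EuclideanSpace ℝ (Fin n))).map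
      fun x => Real.sqrt n • ‖x‖⁻¹ • x := by
  have : NeZero n := ⟨by omega⟩
  exact (map_normalize_stdGaussian _).symm

lemma complexUniformModel_eq_map (hn : 1 ≤ n) :
    complexUniformModel n = (complexGaussianModel n).map
      fun x => Real.sqrt n • ‖x‖⁻¹ • x := by
  have : NeZero n := ⟨by omega⟩
  have hN : Measurable fun x : EuclideanSpace ℂ (Fin n) => Real.sqrt n • ‖x‖⁻¹ • x := by fun_prop
  have hc : Measurable fun a : EuclideanSpace ℂ (Fin n) => (((Real.sqrt 2)⁻¹ : ℝ) : ℂ) • a :=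
    (continuous_const_smul _).measurable
  rw [complexGaussianModel_eq_map_stdGaussian, Measure.map_map hN hc, complexUniformModel,
    ← map_normalize_stdGaussian]
  congr 1
  funext x
  have h2 : (0 : ℝ) < (Real.sqrt 2)⁻¹ := by positivity
  simp only [Function.comp_apply]
  rw [Complex.coe_smul, norm_smul, Real.norm_of_nonneg h2.le, mul_inv, smul_smul (_ * _),
    mul_right_comm, inv_mul_cancel₀ h2.ne', one_mul]

end Models

end PhaseLift

theorem theorem3 :
    ∃ c₀ γ C C₀ K : ℝ, 0 < c₀ ∧ 0 < γ ∧ 0 < C ∧ 0 < C₀ ∧ 0 < K ∧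
      ∀ (n m : ℕ), 1 ≤ n → c₀ * (n : ℝ) ≤ (m : ℝ) →
      ∀ (Ω : Type*) [MeasurableSpace Ω] (P : Measure Ω) [IsProbabilityMeasure P],
        (∀ a : Fin m → Ω → EuclideanSpace ℂ (Fin n),
          PhaseLift.IsIID a (PhaseLift.complexGaussianModel n) P →
          P {ω | ¬ PhaseLift.StableRecovery C₀ K (fun i => a i ω)} ≤
            ENNReal.ofReal (C * Real.exp (-γ * m))) ∧
        (∀ a : Fin m → Ω → EuclideanSpace ℝ (Fin n),
          PhaseLift.IsIID a (PhaseLift.realGaussianModel n) P →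
          P {ω | ¬ PhaseLift.StableRecovery C₀ K (fun i => a i ω)} ≤
            ENNReal.ofReal (C * Real.exp (-γ * m))) ∧
        (∀ a : Fin m → Ω → EuclideanSpace ℂ (Fin n),
          PhaseLift.IsIID a (PhaseLift.complexUniformModel n) P →
          P {ω | ¬ PhaseLift.StableRecovery C₀ K (fun i => a i ω)} ≤
            ENNReal.ofReal (C * Real.exp (-γ * n))) ∧
        (∀ a : Fin m → Ω → EuclideanSpace ℝ (Fin n),
          PhaseLift.IsIID a (PhaseLift.realUniformModel n) P →
          P {ω | ¬ PhaseLift.StableRecovery C₀ K (fun i => a i ω)} ≤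
            ENNReal.ofReal (C * Real.exp (-γ * n))) := by
  have hc : 0 < PhaseLift.isometryConst := by unfold PhaseLift.isometryConst; positivity
  refine ⟨2 ^ 25 * 16385, 1 / 2 ^ 23, 3, 6 * (2 / PhaseLift.isometryConst + 1),
    4 / PhaseLift.isometryConst, by norm_num, by norm_num, by norm_num, by positivity,
    by positivity, ?_⟩
  intro n m hn hm Ω _ P _
  obtain ⟨NR, hR1, hRnet, hRcard⟩ := PhaseLift.exists_net_of_finrank_le (n := n)
    (E := EuclideanSpace ℝ (Fin n)) (by simp; omega)
  obtain ⟨NC, hC1, hCnet, hCcard⟩ := PhaseLift.exists_net_of_finrank_le (n := n)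
    (E := EuclideanSpace ℂ (Fin n)) (by rw [finrank_real_of_complex]; simp)
  have hCν := PhaseLift.isCertifying_complexGaussianModel n
  have hRν := PhaseLift.isCertifying_stdGaussian (E := EuclideanSpace ℝ (Fin n))
  -- The argument gives the rate `m` in the uniform models too; it is weakened to `n`, using `m ≥
  -- n`.
  have hmn : ENNReal.ofReal (3 * Real.exp (-(1 / 2 ^ 23) * m)) ≤
      ENNReal.ofReal (3 * Real.exp (-(1 / 2 ^ 23) * n)) := by
    have hn0 : (0 : ℝ) ≤ n := Nat.cast_nonneg n
    refine ENNReal.ofReal_le_ofReal ?_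
    gcongr 3 * Real.exp ?_
    linarith
  refine ⟨fun a ha => ?_, fun a ha => ?_, fun a ha => ?_, fun a ha => ?_⟩
  -- The Gaussian models are the case where the rescaling map is the identity.
  · rw [← Measure.map_id (μ := PhaseLift.complexGaussianModel n)] at ha
    exact hCν.measure_not_stableRecovery_le hn hm hC1 hCnet hCcard measurable_id
      (PhaseLift.exists_scale_id n) ha
  · rw [PhaseLift.realGaussianModel,
      ← Measure.map_id (μ := stdGaussian (EuclideanSpace ℝ (Fin n)))] at ha
    exact hRν.measure_not_stableRecovery_le hn hm hR1 hRnet hRcard measurable_id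
      (PhaseLift.exists_scale_id n) ha
  · rw [PhaseLift.complexUniformModel_eq_map hn] at ha
    exact (hCν.measure_not_stableRecovery_le hn hm hC1 hCnet hCcard (by fun_prop)
      (PhaseLift.exists_scale_normalize hn) ha).trans hmn
  · rw [PhaseLift.realUniformModel_eq_map hn] at ha
    exact (hRν.measure_not_stableRecovery_le hn hm hR1 hRnet hRcard (by fun_prop)
      (PhaseLift.exists_scale_normalize hn) ha).trans hmn
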